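/- Let $(X,\mu)$ be a probability space (in particular, any standard probability space is allowed). A *graphon* on $X$ is a measurable function $w:X\times X\to[0,1]$ with $w(x,y)=w(y,x)$ for almost every $(x,y)$. Its integral operator $T_w$ on the complex Hilbert space $L^2(X)$, $(T_w\xi)(x)=\int_X w(x,y)\xi(y)\,d\mu(y)$, is compact and self-adjoint. Its nonzero eigenvalues, repeated according to multiplicity, are listed as $$\lambda_1(w)\ge\lambda_2(w)\ge\dots\ge 0\ge\dots\ge\lambda_{-2}(w)\ge\lambda_{-1}(w),$$ and its distinct nonzero eigenvalues are listed in the same way as $\mu_1(w)>\mu_2(w)>\cdots$ (the positive ones) and $\mu_{-1}(w)<\mu_{-2}(w)<\cdots$ (the negative ones); each of these sequences is padded with zeros if it is finite. The index set is $\mathbb Z^*=\mathbb Z\setminus\{0\}$. Put $I_w=\{i\in\mathbb Z^*:\lambda_i(w)\ne0\}$, choose an orthonormal family $(\phi_i)_{i\in I_w}$ with $T_w\phi_i=\lambda_i(w)\phi_i$, and for $I\subseteq\mathbb Z^*$ let $$P^w_I\,\xi=\sum_{i\in I\cap I_w}\langle \xi,\phi_i\rangle\phi_i ,$$ an orthogonal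 projection, which is zero if $I\cap I_w=\emptyset$. Let $P^w_0$ be the orthogonal projection onto the null space of $T_w$. Let $w$ and $w_n$ ($n\in\mathbb N$) be graphons on $X$ and $f,f_n\in L^2(X)$, such that $(w_n,f_n)$ converges in norm to $(w,f)$, that is, $$\|w_n-w\|_\Box=\sup_{S,T\subseteq X\text{ measurable}}\Big|\int_{S\times T}(w_n-w)\,d(\mu\times\mu)\Big|\to0\quad\text{and}\quad \|f_n-f\|_2\to0 .$$ For $j\in\mathbb Z^*$ put $\mu_j=\mu_j(w)$ and $I_{\mu_j}=\{i\in I_w:\lambda_i(w)=\mu_j\}$ (so these index sets are determined by the limit $w$, and $I_{\mu_j}=\emptyset$ if $\mu_j=0$). Then, for every choice of the orthonormal families of eigenvectors of $T_w$ and of all the $T_{w_n}$: 1. For every $j\in\mathbb Z^*$ with $\mu_j\neq0$, $P^{w_n}_{I_{\mu_j}}\to P^{w}_{I_{\mu_j}}$ in Hilbert–Schmidt norm, and $P^{w_n}_{I_{\mu_j}}(f_n)\to P^{w}_{I_{\mu_j}}(f)$ in $L^2(X)$, as $n\to\infty$. 2. If moreover $P^w_0(f)=0$, then $$\sum_{j\in\mathbb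 Z^*}\big\|P^{w_n}_{I_{\mu_j}}(f_n)-P^{w}_{I_{\mu_j}}(f)\big\|_2^2\to0\qquad\text{as }n\to\infty .$$ -/

import Mathlib

open MeasureTheory Filter Topology
open scoped ENNReal

/-! ## Spectral data of a bounded operator on a complex Hilbert space -/

section Operators

variable {H : Type*} [NormedAddCommGroup H] [InnerProductSpace ℂ H]

/-- The `k`-th largest positive eigenvalue of `T` (for `k ≥ 1`), eigenvalues being repeated
according to their multiplicity: the largest `t > 0` such that the eigenvalues in `[t, ∞)` have
total multiplicity at least `k`. It is `0` (the supremum of the empty set) if `T` has fewer than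
`k` positive eigenvalues. -/
noncomputable def posEigenvalue (T : H →L[ℂ] H) (k : ℕ) : ℝ :=
  sSup {t : ℝ | 0 < t ∧
    k ≤ Module.finrank ℂ
      (⨆ (s : ℝ) (_ : t ≤ s), Module.End.eigenspace (T : H →ₗ[ℂ] H) (s : ℂ) : Submodule ℂ H)}

/-- The `k`-th largest positive eigenvalue of `T` (for `k ≥ 1`), each eigenvalue being counted
once; `0` if `T` has fewer than `k` distinct positive eigenvalues. -/
noncomputable def posDistinctEigenvalue (T : H →L[ℂ] H) (k : ℕ) : ℝ :=
  sSup {t : ℝ | 0 < t ∧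
    k ≤ Set.ncard {s : ℝ | t ≤ s ∧ Module.End.HasEigenvalue (T : H →ₗ[ℂ] H) (s : ℂ)}}

/-- The repeated nonzero eigenvalues `λ₁ ≥ λ₂ ≥ … ≥ 0 ≥ … ≥ λ₋₂ ≥ λ₋₁` of `T`, padded with zeros.
The index `0` is not used; its value is set to `0`. -/
noncomputable def orderedEigenvalue (T : H →L[ℂ] H) (i : ℤ) : ℝ :=
  if 0 < i then posEigenvalue T i.natAbs
  else if i < 0 then -posEigenvalue (-T) i.natAbs
  else 0

/-- The distinct nonzero eigenvalues `μ₁ > μ₂ > … > 0 > … > μ₋₂ > μ₋₁` of `T`, padded with zeros.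
The index `0` is not used; its value is set to `0`. -/
noncomputable def distinctEigenvalue (T : H →L[ℂ] H) (j : ℤ) : ℝ :=
  if 0 < j then posDistinctEigenvalue T j.natAbs
  else if j < 0 then -posDistinctEigenvalue (-T) j.natAbs
  else 0

/-- The set of indices `i` with `λᵢ ≠ 0`. -/
def eigenIndices (T : H →L[ℂ] H) : Set ℤ := {i | orderedEigenvalue T i ≠ 0}

/-- The set of indices `i` with `λᵢ ≠ 0` and `λᵢ = μⱼ`. -/
def eigenBlock (T : H →L[ℂ] H) (j : ℤ) : Set ℤ :=
  {i | i ∈ eigenIndices T ∧ orderedEigenvalue T i = distinctEigenvalue T j}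

/-- `φ` is an orthonormal family of eigenvectors of `T` associated with the repeated nonzero
eigenvalues. Only the values `φ i` for `i` in `eigenIndices T` matter. -/
structure IsEigenfamily (T : H →L[ℂ] H) (φ : ℤ → H) : Prop where
  orthonormal : Orthonormal ℂ (fun i : eigenIndices T => φ i)
  eigen : ∀ i ∈ eigenIndices T, T (φ i) = (orderedEigenvalue T i : ℂ) • φ i

variable [CompleteSpace H]

/-- The projection `P_I = ∑_{i ∈ I} φᵢ ⊗ φᵢ` (indices outside `eigenIndices T` contribute nothing),
that is, the orthogonal projection onto the closed span of the `φ i`;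
see `hasSum_spectralProjection`. -/
noncomputable def spectralProjection (T : H →L[ℂ] H) (φ : ℤ → H) (I : Set ℤ) : H →L[ℂ] H :=
  (Submodule.span ℂ (φ '' (I ∩ eigenIndices T))).topologicalClosure.starProjection

/-- The orthogonal projection onto the null space of `T`. -/
noncomputable def kernelProjection (T : H →L[ℂ] H) : H →L[ℂ] H :=
  haveI : CompleteSpace (LinearMap.ker (T : H →ₗ[ℂ] H)) :=
    T.isClosed_ker.completeSpace_coe
  (LinearMap.ker (T : H →ₗ[ℂ] H)).starProjection

theorem hasSum_spectralProjection {T : H →L[ℂ] H} {φ : ℤ → H} (hφ : IsEigenfamily T φ)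
    (I : Set ℤ) (ξ : H) :
    HasSum (fun i : (I ∩ eigenIndices T : Set ℤ) => InnerProductSpace.rankOne ℂ (φ i) (φ i) ξ)
      (spectralProjection T φ I ξ) := by
  set K := (Submodule.span ℂ (φ '' (I ∩ eigenIndices T))).topologicalClosure with hK
  have hmem : ∀ i : (I ∩ eigenIndices T : Set ℤ), φ i ∈ K := fun i =>
    Submodule.le_topologicalClosure _ (Submodule.subset_span ⟨i, i.2, rfl⟩)
  let v : (I ∩ eigenIndices T : Set ℤ) → K := fun i => ⟨φ i, hmem i⟩
  have ho : Orthonormal ℂ (fun i : (I ∩ eigenIndices T : Set ℤ) => φ i) :=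
    hφ.orthonormal.comp (fun i : (I ∩ eigenIndices T : Set ℤ) => ⟨i.1, i.2.2⟩)
      (fun a b h => Subtype.ext (by simpa using h))
  have hv : Orthonormal ℂ v := by
    constructor
    · intro i; exact ho.1 i
    · intro i j hij; exact ho.2 hij
  have hbot : (Submodule.span ℂ (Set.range v))ᗮ = ⊥ := by
    rw [eq_bot_iff]
    intro x hx
    have hx' : ∀ i : (I ∩ eigenIndices T : Set ℤ), inner ℂ (φ i.1) (x : H) = 0 := fun i =>
      (Submodule.mem_orthogonal _ _).1 hx (v i) (Submodule.subset_span ⟨i, rfl⟩)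
    have h1 : (x : H) ∈ (Submodule.span ℂ (φ '' (I ∩ eigenIndices T)))ᗮ := by
      rw [Submodule.mem_orthogonal]
      intro u hu
      induction hu using Submodule.span_induction with
      | mem u hu => obtain ⟨i, hi, rfl⟩ := hu; exact hx' ⟨i, hi⟩
      | zero => simp
      | add a b _ _ ha hb => rw [inner_add_left, ha, hb, add_zero]
      | smul c a _ ha => rw [inner_smul_left, ha, mul_zero]
    rw [← Submodule.orthogonal_closure] at h1
    have h2 := (Submodule.mem_orthogonal _ _).1 h1 (x : H) x.2
    rw [Submodule.mem_bot]
    exact Subtype.ext (inner_self_eq_zero.1 h2)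
  let b := HilbertBasis.mkOfOrthogonalEqBot hv hbot
  have hb : ∀ i, ((b i : K) : H) = φ i := fun i => by
    simp only [b, HilbertBasis.coe_mkOfOrthogonalEqBot]; rfl
  have h := b.hasSum_orthogonalProjectionOnto ξ
  have h' := h.mapL K.subtypeL
  have he : (fun i : (I ∩ eigenIndices T : Set ℤ) =>
      InnerProductSpace.rankOne ℂ (φ i) (φ i) ξ) =
      fun i => K.subtypeL (inner ℂ ((b i : K) : H) ξ • b i) := by
    funext i
    rw [map_smul, Submodule.subtypeL_apply, hb]
    rfl
  rw [he]
  exact h'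

/-- The Hilbert–Schmidt norm `(∑ᵢ ‖A eᵢ‖²)^{1/2}`, with values in `[0, ∞]`, computed in some
Hilbert basis `(eᵢ)` of `H` (it does not depend on the basis). -/
noncomputable def hilbertSchmidtNorm (A : H →L[ℂ] H) : ℝ≥0∞ :=
  (∑' e : (exists_hilbertBasis ℂ H).choose, ‖A (e : H)‖ₑ ^ 2) ^ (1 / 2 : ℝ)

end Operators

/-! ## Graphons on a probability space -/

section Graphons

variable {X : Type*} [MeasurableSpace X] {μ : Measure X}

/-- A graphon represented on `(X, μ)`: a measurable function `w : X × X → [0, 1]` with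
`w(x, y) = w(y, x)` almost everywhere. Measurability refers to the completion of `μ × μ`. -/
structure Graphon (μ : Measure X) where
  toFun : X → X → ℝ
  aestronglyMeasurable : AEStronglyMeasurable (fun p : X × X => toFun p.1 p.2) (μ.prod μ)
  mem_Icc : ∀ x y, toFun x y ∈ Set.Icc (0 : ℝ) 1
  symm : ∀ᵐ p ∂μ.prod μ, toFun p.1 p.2 = toFun p.2 p.1

/-- The cut norm `sup_{S, T} |∫_{S × T} U|` over measurable `S, T ⊆ X`. -/
noncomputable def cutNorm (μ : Measure X) (U : X → X → ℝ) : ℝ≥0∞ :=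
  ⨆ (S : Set X) (T : Set X) (_ : MeasurableSet S) (_ : MeasurableSet T),
    ‖∫ p in S ×ˢ T, U p.1 p.2 ∂μ.prod μ‖ₑ

namespace Graphon

/-- The function `x ↦ ∫ w(x, y) ξ(y) dμ(y)`. -/
noncomputable def apply (w : Graphon μ) (ξ : X → ℂ) (x : X) : ℂ :=
  ∫ y, (w.toFun x y : ℂ) * ξ y ∂μ

theorem norm_toFun_le (w : Graphon μ) (x y : X) : ‖(w.toFun x y : ℂ)‖ ≤ 1 := by
  have h := w.mem_Icc x y
  rw [Complex.norm_real, Real.norm_eq_abs, abs_of_nonneg h.1]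
  exact h.2

variable [IsProbabilityMeasure μ]

theorem ae_integrable (w : Graphon μ) (ξ : Lp ℂ 2 μ) :
    ∀ᵐ x ∂μ, Integrable (fun y => (w.toFun x y : ℂ) * ξ y) μ := by
  have hξ : Integrable ξ μ := (Lp.memLp ξ).integrable (by norm_num)
  filter_upwards [w.aestronglyMeasurable.prodMk_left] with x hx
  exact hξ.bdd_mul (Complex.continuous_ofReal.comp_aestronglyMeasurable hx)
    (Eventually.of_forall fun y => w.norm_toFun_le x y)

theorem norm_apply_le (w : Graphon μ) (ξ : Lp ℂ 2 μ) (x : X) : ‖w.apply ξ x‖ ≤ ‖ξ‖ := by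
  have hξ : Integrable ξ μ := (Lp.memLp ξ).integrable (by norm_num)
  calc ‖w.apply ξ x‖ ≤ ∫ y, ‖(ξ : X → ℂ) y‖ ∂μ := by
        refine norm_integral_le_of_norm_le hξ.norm (Eventually.of_forall fun y => ?_)
        rw [norm_mul]
        exact mul_le_of_le_one_left (norm_nonneg _) (w.norm_toFun_le x y)
    _ ≤ ‖ξ‖ := by
        rw [integral_norm_eq_lintegral_enorm (Lp.aestronglyMeasurable ξ), Lp.norm_def]
        refine ENNReal.toReal_mono (Lp.eLpNorm_ne_top ξ) ?_
        rw [← eLpNorm_one_eq_lintegral_enorm]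
        exact eLpNorm_le_eLpNorm_of_exponent_le (by norm_num) (Lp.aestronglyMeasurable ξ)

theorem memLp_apply (w : Graphon μ) (ξ : Lp ℂ 2 μ) : MemLp (w.apply ξ) 2 μ := by
  refine MemLp.of_bound ?_ ‖ξ‖ (Eventually.of_forall (w.norm_apply_le ξ))
  refine AEStronglyMeasurable.integral_prod_right'
    (f := fun p : X × X => (w.toFun p.1 p.2 : ℂ) * ξ p.2) ?_
  exact (Complex.continuous_ofReal.comp_aestronglyMeasurable w.aestronglyMeasurable).mul
    (Lp.aestronglyMeasurable ξ).comp_snd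

/-- The integral operator `T_w` on `L²(X)` with kernel `w`. -/
noncomputable def operator (w : Graphon μ) : Lp ℂ 2 μ →L[ℂ] Lp ℂ 2 μ :=
  LinearMap.mkContinuous
    { toFun := fun ξ => (w.memLp_apply ξ).toLp (w.apply ξ)
      map_add' := fun ξ η => by
        rw [← MemLp.toLp_add, MemLp.toLp_eq_toLp_iff]
        filter_upwards [w.ae_integrable ξ, w.ae_integrable η] with x h1 h2
        simp only [Graphon.apply, Pi.add_apply]
        rw [← integral_add h1 h2]
        refine integral_congr_ae ?_
        filter_upwards [Lp.coeFn_add ξ η] with y hy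
        rw [hy, Pi.add_apply, mul_add]
      map_smul' := fun c ξ => by
        rw [RingHom.id_apply, ← MemLp.toLp_const_smul, MemLp.toLp_eq_toLp_iff]
        refine Eventually.of_forall fun x => ?_
        simp only [Graphon.apply, Pi.smul_apply]
        rw [← integral_smul]
        refine integral_congr_ae ?_
        filter_upwards [Lp.coeFn_smul c ξ] with y hy
        rw [hy, Pi.smul_apply, smul_eq_mul, smul_eq_mul]
        ring }
    1 (fun ξ => by
      refine (Lp.norm_le_of_ae_bound (norm_nonneg ξ) (f := (w.memLp_apply ξ).toLp (w.apply ξ))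
        (C := ‖ξ‖) ?_).trans ?_
      · filter_upwards [(w.memLp_apply ξ).coeFn_toLp] with x hx
        rw [hx]
        exact w.norm_apply_le ξ x
      · simp [measureUnivNNReal])

theorem operator_coeFn (w : Graphon μ) (ξ : Lp ℂ 2 μ) :
    w.operator ξ =ᵐ[μ] fun x => ∫ y, (w.toFun x y : ℂ) * ξ y ∂μ :=
  (w.memLp_apply ξ).coeFn_toLp

end Graphon

/-- Convergence in norm of graphon signals: cut norm for the graphons, `L²` norm for the
signals. -/
def SignalsConvergeInNorm (w' : ℕ → Graphon μ) (f' : ℕ → Lp ℂ 2 μ) (w : Graphon μ)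
    (f : Lp ℂ 2 μ) : Prop :=
  Tendsto (fun n => cutNorm μ (fun x y => (w' n).toFun x y - w.toFun x y)) atTop (𝓝 0) ∧
    Tendsto (fun n => ‖f' n - f‖) atTop (𝓝 0)

end Graphons

/-! ### Symmetric Hilbert–Schmidt operators and their diagonalization. -/

section HilbertSchmidt

variable {H : Type*} [NormedAddCommGroup H] [InnerProductSpace ℂ H]

/-! The graphs enter only through their operators. A kernel `U` with values in `[-1, 1]` and small
cut norm sends bounded functions to functions small in `L¹`, hence in `L²`, because the image is
also bounded; an unbounded unit vector is truncated, and its tail is small in `L¹`, which `U` maps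
into `L∞`. So cut convergence gives operator norm convergence (`Graphon.tendsto_operator`), and each
operator has squared Hilbert–Schmidt norm at most 1.

The rest is perturbation theory on a Hilbert space. By Weyl's inequality
(`abs_orderedEigenvalue_sub_le`) the eigenvalues of `T' n` with index in the block of `c = μⱼ` tend
to `c`, so their unit eigenvectors are approximate eigenvectors of `T` for `c`. As `c` is isolated
in the spectrum of `T`, such vectors are close to the `c`-eigenspace
(`exists_norm_sub_spectralProjection_le`). For two projections of equal finite rank this one-sided
closeness already controls the Hilbert–Schmidt distance (`hasSum_norm_spectralProjection_sub_sq`).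

For the sum over all blocks, each term converges by the above. Bessel bounds the total mass at stage
`n` by `‖f' n‖²`, and the limit has mass exactly `‖f‖²` because `f` is orthogonal to the kernel. No
mass can then escape to infinity in `j`, and termwise convergence becomes `ℓ²` convergence
(`tendsto_tsum_enorm_sub_sq`). -/

theorem HilbertBasis.hasSum_norm_inner_sq {ι : Type*} (b : HilbertBasis ι ℂ H) (v : H) :
    HasSum (fun i => ‖inner ℂ (b i) v‖ ^ 2) (‖v‖ ^ 2) := by
  have h := Complex.hasSum_re (b.hasSum_inner_mul_inner v v)
  rw [inner_self_eq_norm_sq_to_K] at h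
  convert h using 1
  · funext i
    rw [← inner_conj_symm v, Complex.conj_mul']
    norm_cast
  · norm_cast

theorem HilbertBasis.norm_sub_sum_sq {ι : Type*} (b : HilbertBasis ι ℂ H) (F : Finset ι) (v : H) :
    ‖v - ∑ i ∈ F, inner ℂ (b i) v • b i‖ ^ 2 =
      ∑' i : {i // i ∉ F}, ‖inner ℂ (b i) v‖ ^ 2 := by
  classical
  rw [← (b.hasSum_norm_inner_sq (v - ∑ i ∈ F, inner ℂ (b i) v • b i)).tsum_eq]
  have hcoef : ∀ i, inner ℂ (b i) (v - ∑ k ∈ F, inner ℂ (b k) v • b k) =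
      if i ∈ F then 0 else inner ℂ (b i) v := by
    intro i
    rw [inner_sub_right, inner_sum]
    simp only [inner_smul_right, orthonormal_iff_ite.1 b.orthonormal, mul_ite, mul_one, mul_zero,
      Finset.sum_ite_eq]
    split_ifs <;> simp
  simp only [hcoef]
  refine Eq.trans (tsum_congr fun i => ?_)
    (tsum_subtype {i | i ∉ F} (fun i => ‖inner ℂ (b i) v‖ ^ 2)).symm
  by_cases hi : i ∈ F <;> simp [hi]

/-- `T` is symmetric, and its squared Hilbert–Schmidt norm is at most `C`. -/
structure IsHilbertSchmidtSymmetric (T : H →L[ℂ] H) (C : ℝ) : Prop where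
  isSymmetric : (T : H →ₗ[ℂ] H).IsSymmetric
  sum_le' : ∀ F : Finset H, Orthonormal ℂ ((↑) : F → H) → ∑ e ∈ F, ‖T e‖ ^ 2 ≤ C

namespace IsHilbertSchmidtSymmetric

variable {T : H →L[ℂ] H} {C : ℝ}

theorem inner_apply (hT : IsHilbertSchmidtSymmetric T C) (u v : H) :
    inner ℂ (T u) v = inner ℂ u (T v) := hT.isSymmetric u v

theorem neg (hT : IsHilbertSchmidtSymmetric T C) : IsHilbertSchmidtSymmetric (-T) C where
  isSymmetric := fun u v => by
    have := hT.inner_apply u v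
    simp [this]
  sum_le' := fun F hF => by simpa using hT.sum_le' F hF

theorem sum_le (hT : IsHilbertSchmidtSymmetric T C) {ι : Type*} {e : ι → H}
    (he : Orthonormal ℂ e) (F : Finset ι) : ∑ i ∈ F, ‖T (e i)‖ ^ 2 ≤ C := by
  classical
  have h := hT.sum_le' (F.image e) ?_
  · rwa [Finset.sum_image he.linearIndependent.injective.injOn] at h
  · have : ∀ x : F.image e, ∃ i, e i = x := fun x => by
      obtain ⟨i, -, hi⟩ := Finset.mem_image.1 x.2
      exact ⟨i, hi⟩
    choose g hg using this
    have hg' : (Subtype.val : F.image e → H) = e ∘ g := by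
      funext x; exact (hg x).symm
    rw [hg']
    refine he.comp g fun x y hxy => Subtype.ext ?_
    rw [← hg x, ← hg y, hxy]

theorem summable (hT : IsHilbertSchmidtSymmetric T C) {ι : Type*} {e : ι → H}
    (he : Orthonormal ℂ e) : Summable fun i => ‖T (e i)‖ ^ 2 :=
  summable_of_sum_le (fun _ => by positivity) (hT.sum_le he)

/-- Each such vector contributes at least `t²` to a sum bounded by `C`. -/
theorem finite_of_le_norm (hT : IsHilbertSchmidtSymmetric T C) {ι : Type*} {e : ι → H}
    (he : Orthonormal ℂ e) {t : ℝ} (ht : 0 < t) : {i | t ≤ ‖T (e i)‖}.Finite := by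
  by_contra hinf
  obtain ⟨n, hn⟩ := exists_nat_gt (C / t ^ 2)
  obtain ⟨F, hF, hcard⟩ := Set.Infinite.exists_subset_card_eq hinf n
  have h1 := hT.sum_le he F
  have h2 : ∑ i ∈ F, t ^ 2 ≤ ∑ i ∈ F, ‖T (e i)‖ ^ 2 :=
    Finset.sum_le_sum fun i hi => by
      have : t ≤ ‖T (e i)‖ := hF hi
      gcongr
  rw [Finset.sum_const, hcard, nsmul_eq_mul] at h2
  rw [div_lt_iff₀ (by positivity)] at hn
  linarith

/-- The finite-rank truncations of `T` in a Hilbert basis converge to it in operator norm: by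
Parseval and Cauchy–Schwarz the error is at most the square root of the tail of `∑ ‖T bᵢ‖²`. -/
theorem isCompactOperator [CompleteSpace H] (hT : IsHilbertSchmidtSymmetric T C) :
    IsCompactOperator T := by
  classical
  obtain ⟨w, b, -⟩ := exists_hilbertBasis ℂ H
  let A : Finset w → (H →L[ℂ] H) := fun F => ∑ i ∈ F, (innerSL ℂ (T (b i))).smulRight (b i)
  have hA : ∀ F v, A F v = ∑ i ∈ F, inner ℂ (b i) (T v) • b i := by
    intro F v
    simp [A, hT.inner_apply]
  have hsum := hT.summable b.orthonormal
  have hlim : Tendsto A atTop (𝓝 T) := by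
    rw [tendsto_iff_norm_sub_tendsto_zero]
    have htail := tendsto_tsum_compl_atTop_zero (fun i => ‖T (b i)‖ ^ 2)
    have hsq := htail.sqrt
    rw [Real.sqrt_zero] at hsq
    refine squeeze_zero (fun _ => norm_nonneg _) (fun F => ?_) hsq
    refine ContinuousLinearMap.opNorm_le_bound _ (Real.sqrt_nonneg _) fun v => ?_
    have h0 : 0 ≤ ∑' i : {i // i ∉ F}, ‖T (b i)‖ ^ 2 := tsum_nonneg fun _ => by positivity
    refine le_of_sq_le_sq ?_ (by positivity)
    rw [mul_pow, Real.sq_sqrt h0, sub_apply, norm_sub_rev, hA,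
      b.norm_sub_sum_sq, ← tsum_mul_right]
    refine Summable.tsum_le_tsum (fun i => ?_) ?_ ?_
    · rw [← mul_pow, ← hT.inner_apply]
      have := norm_inner_le_norm (𝕜 := ℂ) (T (b i)) v
      gcongr
    · exact (b.hasSum_norm_inner_sq (T v)).summable.subtype _
    · exact (hsum.subtype _).mul_right _
  refine isCompactOperator_of_tendsto hlim (Eventually.of_forall fun F => ?_)
  refine Submodule.sum_mem (compactOperator (RingHom.id ℂ) H H) fun i _ => ?_
  change IsCompactOperator fun v => (innerSL ℂ (T (b i))) v • b i
  have h : IsCompactOperator (innerSL ℂ (T (b i))) :=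
    isCompactOperator_of_locallyCompactSpace_dom _
  exact h.clm_comp (ContinuousLinearMap.toSpanSingleton ℂ (b i))

end IsHilbertSchmidtSymmetric

/-- A Hilbert basis of eigenvectors of a symmetric operator, with finitely many eigenvalues
outside every neighbourhood of zero. -/
structure Diagonalization (T : H →L[ℂ] H) (ι : Type*) where
  basis : HilbertBasis ι ℂ H
  eigval : ι → ℝ
  apply_basis : ∀ i, T (basis i) = (eigval i : ℂ) • basis i
  isSymmetric : (T : H →ₗ[ℂ] H).IsSymmetric
  finite_le_abs : ∀ t > 0, {i | t ≤ |eigval i|}.Finite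

/-- Spectral theorem for compact self-adjoint operators: Hilbert bases of the eigenspaces are glued
together. -/
theorem IsHilbertSchmidtSymmetric.exists_diagonalization.{u} {H : Type u} [NormedAddCommGroup H]
    [InnerProductSpace ℂ H] [CompleteSpace H] {T : H →L[ℂ] H} {C : ℝ}
    (hT : IsHilbertSchmidtSymmetric T C) : ∃ ι : Type u, Nonempty (Diagonalization T ι) := by
  -- All complex `c` are allowed, most eigenspaces being trivial; symmetry later shows that only
  -- real ones carry basis vectors.
  let V : ℂ → Submodule ℂ H := fun c => Module.End.eigenspace (T : H →ₗ[ℂ] H) c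
  have hclosed : ∀ c, IsClosed (V c : Set H) := fun c => by
    have : (V c : Set H) = {v | T v = c • v} := by
      ext v; simp [V]
    rw [this]
    exact isClosed_eq T.continuous (continuous_const_smul c)
  have : ∀ c, CompleteSpace (V c) := fun c => (hclosed c).completeSpace_coe
  choose W B hB using fun c => exists_hilbertBasis ℂ (V c)
  have hortho : Orthonormal ℂ fun a : Σ c, W c => (((B a.1) a.2 : V a.1) : H) :=
    hT.isSymmetric.orthogonalFamily_eigenspaces.orthonormal_sigma_orthonormal
    (fun c => (B c).orthonormal)
  have hbot : (Submodule.span ℂ (Set.range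
      fun a : Σ c, W c => (((B a.1) a.2 : V a.1) : H)))ᗮ = ⊥ := by
    rw [eq_bot_iff, ← ContinuousLinearMap.orthogonalComplement_iSup_eigenspaces_eq_bot
      hT.isCompactOperator hT.isSymmetric]
    refine (Submodule.le_orthogonal_orthogonal _).trans
      (Submodule.orthogonal_le (iSup_le fun c v hv => ?_))
    rw [Submodule.orthogonal_orthogonal_eq_closure]
    have h1 := ((B c).hasSum_repr ⟨v, hv⟩).mapL (V c).subtypeL
    refine mem_closure_of_tendsto h1 (Eventually.of_forall fun F => ?_)
    refine Submodule.sum_mem _ fun i _ => ?_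
    rw [map_smul]
    exact Submodule.smul_mem _ _ (Submodule.subset_span ⟨⟨c, i⟩, rfl⟩)
  let b := HilbertBasis.mkOfOrthogonalEqBot hortho hbot
  have hb : ∀ a : Σ c, W c, b a = (((B a.1) a.2 : V a.1) : H) := fun a => by
    simp only [b, HilbertBasis.coe_mkOfOrthogonalEqBot]
  have happ : ∀ a, T (b a) = a.1 • b a := fun a => by
    have := ((B a.1) a.2).2
    rw [hb]
    exact Module.End.mem_eigenspace_iff.1 this
  have hne : ∀ a, b a ≠ 0 := fun a => b.orthonormal.ne_zero a
  have hreal : ∀ a : Σ c, W c, ((a.1.re : ℝ) : ℂ) = a.1 := fun a => by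
    refine Complex.conj_eq_iff_re.1 (hT.isSymmetric.conj_eigenvalue_eq_self ?_)
    exact Module.End.hasEigenvalue_of_hasEigenvector
      ⟨Module.End.mem_eigenspace_iff.2 (happ a), hne a⟩
  have happ : ∀ a, T (b a) = ((a.1.re : ℝ) : ℂ) • b a := fun a => by rw [hreal, happ]
  refine ⟨_, ⟨⟨b, fun a => a.1.re, happ, hT.isSymmetric, fun t ht => ?_⟩⟩⟩
  refine (hT.finite_of_le_norm b.orthonormal ht).subset fun a ha => ?_
  change t ≤ ‖T (b a)‖
  rw [happ, norm_smul, b.orthonormal.1 a, mul_one, Complex.norm_real]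
  exact ha

end HilbertSchmidt

/-! ### Eigenvalue counting, Weyl's inequality, completeness of eigenfamilies. -/

section Eigenvalues

variable {H : Type*} [NormedAddCommGroup H] [InnerProductSpace ℂ H]

theorem posEigenvalue_nonneg (T : H →L[ℂ] H) (k : ℕ) : 0 ≤ posEigenvalue T k :=
  Real.sSup_nonneg fun _ ht => ht.1.le

theorem posDistinctEigenvalue_nonneg (T : H →L[ℂ] H) (k : ℕ) : 0 ≤ posDistinctEigenvalue T k :=
  Real.sSup_nonneg fun _ ht => ht.1.le

theorem orderedEigenvalue_neg (T : H →L[ℂ] H) (i : ℤ) :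
    orderedEigenvalue (-T) i = -orderedEigenvalue T (-i) := by
  unfold orderedEigenvalue
  rcases lt_trichotomy i 0 with h | rfl | h
  · simp [h, not_lt.2 h.le]
  · simp
  · simp [h, not_lt.2 h.le]

theorem distinctEigenvalue_neg (T : H →L[ℂ] H) (i : ℤ) :
    distinctEigenvalue (-T) i = -distinctEigenvalue T (-i) := by
  unfold distinctEigenvalue
  rcases lt_trichotomy i 0 with h | rfl | h
  · simp [h, not_lt.2 h.le]
  · simp
  · simp [h, not_lt.2 h.le]

theorem orderedEigenvalue_natCast (T : H →L[ℂ] H) {k : ℕ} (hk : 1 ≤ k) :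
    orderedEigenvalue T k = posEigenvalue T k := by
  have : 0 < k := hk
  simp [orderedEigenvalue, this]

theorem distinctEigenvalue_natCast (T : H →L[ℂ] H) {k : ℕ} (hk : 1 ≤ k) :
    distinctEigenvalue T k = posDistinctEigenvalue T k := by
  have : 0 < k := hk
  simp [distinctEigenvalue, this]

theorem exists_natCast_of_distinctEigenvalue_pos {T : H →L[ℂ] H} {i : ℤ}
    (h : 0 < distinctEigenvalue T i) : ∃ k : ℕ, 1 ≤ k ∧ i = k := by
  rcases lt_trichotomy i 0 with hi | rfl | hi
  · have := posDistinctEigenvalue_nonneg (-T) i.natAbs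
    simp only [distinctEigenvalue, not_lt.2 hi.le, hi, if_true, if_false] at h
    linarith
  · simp [distinctEigenvalue] at h
  · exact ⟨i.natAbs, by omega, by omega⟩

theorem neg_mem_eigenIndices {T : H →L[ℂ] H} {i : ℤ} :
    i ∈ eigenIndices (-T) ↔ -i ∈ eigenIndices T := by
  simp [eigenIndices, orderedEigenvalue_neg]

theorem IsEigenfamily.neg {T : H →L[ℂ] H} {φ : ℤ → H} (hφ : IsEigenfamily T φ) :
    IsEigenfamily (-T) (fun i => φ (-i)) where
  orthonormal := hφ.orthonormal.comp
    (fun i : eigenIndices (-T) => (⟨-i.1, neg_mem_eigenIndices.1 i.2⟩ : eigenIndices T))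
    fun x y h => Subtype.ext (neg_injective (congrArg Subtype.val h))
  eigen := fun i hi => by
    rw [neg_apply, hφ.eigen _ (neg_mem_eigenIndices.1 hi), orderedEigenvalue_neg]
    simp

/-- A decreasing counting function that is left-continuous (`hleft`) attains the supremum. This
turns the `sSup` definitions of the eigenvalues into counting statements. -/
theorem le_sSup_setOf_le_iff {f : ℝ → ℕ} {B : ℝ}
    (hanti : ∀ s s', 0 < s → s ≤ s' → f s' ≤ f s)
    (hleft : ∀ s, 0 < s → ∃ s' < s, 0 < s' ∧ f s' = f s)
    (hbdd : ∀ s, 0 < s → 0 < f s → s ≤ B) {k : ℕ} (hk : 1 ≤ k) {t : ℝ} (ht : 0 < t) :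
    t ≤ sSup {t : ℝ | 0 < t ∧ k ≤ f t} ↔ k ≤ f t := by
  constructor
  · intro h
    obtain ⟨t', htt, ht', heq⟩ := hleft t ht
    rw [← heq]
    -- The real supremum of the empty set is `0`, which is below `t`.
    have hne : {t : ℝ | 0 < t ∧ k ≤ f t}.Nonempty := by
      by_contra hne
      rw [Set.not_nonempty_iff_eq_empty.1 hne, Real.sSup_empty] at h
      linarith
    obtain ⟨r, ⟨-, hr⟩, hlt⟩ := exists_lt_of_lt_csSup hne (htt.trans_le h)
    exact hr.trans (hanti _ _ ht' hlt.le)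
  · exact fun h => le_csSup ⟨B, fun r hr => hbdd r hr.1 (hk.trans hr.2)⟩ ⟨ht, h⟩

namespace Diagonalization

variable {T : H →L[ℂ] H} {ι : Type*} (D : Diagonalization T ι)
include D

theorem inner_apply (i : ι) (v : H) :
    inner ℂ (D.basis i) (T v) = (D.eigval i : ℂ) * inner ℂ (D.basis i) v := by
  have h := D.isSymmetric (D.basis i) v
  simp only [ContinuousLinearMap.coe_coe] at h
  rw [← h, D.apply_basis, inner_smul_left, Complex.conj_ofReal]

theorem hasSum_re_inner (v : H) :
    HasSum (fun i => D.eigval i * ‖inner ℂ (D.basis i) v‖ ^ 2) (inner ℂ v (T v)).re := by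
  have h := Complex.hasSum_re (D.basis.hasSum_inner_mul_inner v (T v))
  convert h using 1
  funext i
  rw [D.inner_apply, mul_left_comm, Complex.re_ofReal_mul, ← inner_conj_symm v, Complex.conj_mul']
  norm_cast

theorem hasSum_norm_sub_smul_sq (c : ℝ) (v : H) :
    HasSum (fun i => (D.eigval i - c) ^ 2 * ‖inner ℂ (D.basis i) v‖ ^ 2)
      (‖T v - (c : ℂ) • v‖ ^ 2) := by
  convert D.basis.hasSum_norm_inner_sq (T v - (c : ℂ) • v) using 1
  funext i
  rw [inner_sub_right, D.inner_apply, inner_smul_right, ← sub_mul, norm_mul, mul_pow,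
    ← Complex.ofReal_sub, Complex.norm_real, Real.norm_eq_abs, sq_abs]

/-- As `S` is finite, no closure of the span is needed. The case `S = ∅` serves below to show that a
vector vanishes. -/
theorem mem_span {S : Set ι} (hS : S.Finite) {v : H}
    (hv : ∀ i ∉ S, inner ℂ (D.basis i) v = 0) : v ∈ Submodule.span ℂ (D.basis '' S) := by
  have h := D.basis.hasSum_repr v
  have h2 : HasSum (fun i => D.basis.repr v i • D.basis i)
      (∑ i ∈ hS.toFinset, D.basis.repr v i • D.basis i) := by
    refine hasSum_sum_of_ne_finset_zero fun i hi => ?_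
    rw [D.basis.repr_apply_apply, hv i (by simpa using hi), zero_smul]
  rw [h.unique h2]
  exact Submodule.sum_mem _ fun i hi =>
    Submodule.smul_mem _ _ (Submodule.subset_span ⟨i, by simpa using hi, rfl⟩)

theorem inner_eq_zero_of_mem_span {S : Set ι} {v : H}
    (hv : v ∈ Submodule.span ℂ (D.basis '' S)) {i : ι} (hi : i ∉ S) :
    inner ℂ (D.basis i) v = 0 := by
  induction hv using Submodule.span_induction with
  | mem u hu =>
    obtain ⟨j, hj, rfl⟩ := hu
    exact D.basis.orthonormal.2 fun h => hi (h ▸ hj)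
  | zero => simp
  | add a b _ _ ha hb => rw [inner_add_right, ha, hb, add_zero]
  | smul c a _ ha => rw [inner_smul_right, ha, mul_zero]

theorem inner_eq_zero_of_apply_eq {c : ℝ} {v : H} (hv : T v = (c : ℂ) • v) {i : ι}
    (hi : D.eigval i ≠ c) : inner ℂ (D.basis i) v = 0 := by
  have h := D.inner_apply i v
  rw [hv, inner_smul_right, mul_eq_mul_right_iff] at h
  rcases h with h | h
  · exact absurd (Complex.ofReal_injective h).symm hi
  · exact h

/-- The diagonalization of `-T`. -/
def neg : Diagonalization (-T) ι where
  basis := D.basis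
  eigval := fun i => -D.eigval i
  apply_basis := fun i => by rw [neg_apply, D.apply_basis]; simp
  isSymmetric := fun u v => by simpa using D.isSymmetric u v
  finite_le_abs := fun t ht => by simpa using D.finite_le_abs t ht

theorem finite_le {t : ℝ} (ht : 0 < t) : {i | t ≤ D.eigval i}.Finite :=
  (D.finite_le_abs t ht).subset fun i (hi : t ≤ D.eigval i) => hi.trans (le_abs_self _)

theorem iSup_eigenspace_eq {t : ℝ} (ht : 0 < t) :
    (⨆ (s : ℝ) (_ : t ≤ s), Module.End.eigenspace (T : H →ₗ[ℂ] H) (s : ℂ) : Submodule ℂ H) =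
      Submodule.span ℂ (D.basis '' {i | t ≤ D.eigval i}) := by
  refine le_antisymm (iSup₂_le fun s hs v hv => ?_) (Submodule.span_le.2 ?_)
  · refine D.mem_span (D.finite_le ht) fun i hi => ?_
    refine D.inner_eq_zero_of_apply_eq (Module.End.mem_eigenspace_iff.1 hv) fun h => hi ?_
    exact hs.trans h.ge
  · rintro _ ⟨i, hi, rfl⟩
    exact Submodule.mem_iSup_of_mem (D.eigval i) (Submodule.mem_iSup_of_mem hi
      (Module.End.mem_eigenspace_iff.2 (D.apply_basis i)))

theorem finrank_span {S : Set ι} (hS : S.Finite) :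
    Module.finrank ℂ (Submodule.span ℂ (D.basis '' S)) = S.ncard := by
  have := hS.fintype
  have h : LinearIndependent ℂ (fun i : S => D.basis i) :=
    D.basis.orthonormal.linearIndependent.comp _ Subtype.val_injective
  rw [Set.image_eq_range, finrank_span_eq_card h, ← Nat.card_eq_fintype_card, Nat.card_coe_set_eq]

theorem posEigenvalue_eq (k : ℕ) :
    posEigenvalue T k = sSup {t : ℝ | 0 < t ∧ k ≤ {i | t ≤ D.eigval i}.ncard} := by
  unfold posEigenvalue
  congr 1
  ext t
  refine and_congr_right fun ht => ?_
  rw [D.iSup_eigenspace_eq ht, D.finrank_span (D.finite_le ht)]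

theorem abs_eigval_le (i : ι) : |D.eigval i| ≤ ‖T‖ := by
  have h := T.le_opNorm (D.basis i)
  rwa [D.apply_basis, norm_smul, D.basis.orthonormal.1 i, mul_one, mul_one, Complex.norm_real]
    at h

/-- Left-continuity of the counting function: eigenvalues do not accumulate at `t > 0`. With `m` the
largest eigenvalue in `[t/2, t)`, or `t/2` if there is none, the midpoint of `m` and `t` works. -/
theorem exists_lt_setOf_le_eq {t : ℝ} (ht : 0 < t) :
    ∃ t' < t, 0 < t' ∧ {i | t' ≤ D.eigval i} = {i | t ≤ D.eigval i} := by
  have hfin : (D.eigval '' {i | t / 2 ≤ D.eigval i} ∩ Set.Iio t).Finite :=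
    ((D.finite_le (half_pos ht)).image _).inter_of_left _
  obtain ⟨m, hm, hmax⟩ := (insert (t / 2) hfin.toFinset).exists_max_image id
    ⟨_, Finset.mem_insert_self _ _⟩
  have hm2 : t / 2 ≤ m := hmax _ (Finset.mem_insert_self _ _)
  have hmt : m < t := by
    rcases Finset.mem_insert.1 hm with rfl | h
    · linarith
    · exact ((Set.Finite.mem_toFinset _).1 h).2
  refine ⟨(m + t) / 2, by linarith, by linarith, ?_⟩
  ext i
  refine ⟨fun hi => ?_, fun hi => ?_⟩
  · simp only [Set.mem_ofPred_eq] at hi ⊢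
    by_contra hlt
    push Not at hlt
    have : D.eigval i ≤ m := hmax _ (Finset.mem_insert_of_mem ((Set.Finite.mem_toFinset _).2
      ⟨⟨i, show t / 2 ≤ D.eigval i by linarith, rfl⟩, hlt⟩))
    linarith
  · simp only [Set.mem_ofPred_eq] at hi ⊢
    linarith

theorem ncard_le_antitone {t t' : ℝ} (ht : 0 < t) (h : t ≤ t') :
    {i | t' ≤ D.eigval i}.ncard ≤ {i | t ≤ D.eigval i}.ncard :=
  Set.ncard_le_ncard (fun _ hi => h.trans hi) (D.finite_le ht)

theorem le_norm_of_nonempty {t : ℝ} (h : {i | t ≤ D.eigval i}.Nonempty) : t ≤ ‖T‖ := by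
  obtain ⟨i, hi⟩ := h
  exact le_trans hi ((le_abs_self _).trans (D.abs_eigval_le i))

theorem le_posEigenvalue_iff {k : ℕ} (hk : 1 ≤ k) {t : ℝ} (ht : 0 < t) :
    t ≤ posEigenvalue T k ↔ k ≤ {i | t ≤ D.eigval i}.ncard := by
  rw [D.posEigenvalue_eq]
  refine le_sSup_setOf_le_iff (f := fun t => {i | t ≤ D.eigval i}.ncard) (B := ‖T‖)
    (fun s s' hs hss => D.ncard_le_antitone hs hss) (fun s hs => ?_) (fun s hs h => ?_) hk ht
  · obtain ⟨s', h1, h2, h3⟩ := D.exists_lt_setOf_le_eq hs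
    exact ⟨s', h1, h2, by rw [h3]⟩
  · exact D.le_norm_of_nonempty ((Set.ncard_pos (D.finite_le hs)).1 h)

theorem setOf_hasEigenvalue_eq (t : ℝ) :
    {s : ℝ | t ≤ s ∧ Module.End.HasEigenvalue (T : H →ₗ[ℂ] H) (s : ℂ)} =
      D.eigval '' {i | t ≤ D.eigval i} := by
  ext s
  constructor
  · rintro ⟨hs, h⟩
    obtain ⟨v, hv, hv0⟩ := h.exists_hasEigenvector
    by_contra hcon
    have h0 : ∀ i, inner ℂ (D.basis i) v = 0 := fun i =>
      D.inner_eq_zero_of_apply_eq (Module.End.mem_eigenspace_iff.1 hv) fun heq =>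
        hcon ⟨i, hs.trans heq.ge, heq⟩
    have h1 := D.mem_span Set.finite_empty fun i _ => h0 i
    simp only [Set.image_empty, Submodule.span_empty, Submodule.mem_bot] at h1
    exact hv0 h1
  · rintro ⟨i, hi, rfl⟩
    exact ⟨hi, Module.End.hasEigenvalue_of_hasEigenvector
      ⟨Module.End.mem_eigenspace_iff.2 (D.apply_basis i), D.basis.orthonormal.ne_zero i⟩⟩

theorem posDistinctEigenvalue_eq (k : ℕ) :
    posDistinctEigenvalue T k =
      sSup {t : ℝ | 0 < t ∧ k ≤ (D.eigval '' {i | t ≤ D.eigval i}).ncard} := by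
  simp only [posDistinctEigenvalue, D.setOf_hasEigenvalue_eq]

theorem le_posDistinctEigenvalue_iff {k : ℕ} (hk : 1 ≤ k) {t : ℝ} (ht : 0 < t) :
    t ≤ posDistinctEigenvalue T k ↔ k ≤ (D.eigval '' {i | t ≤ D.eigval i}).ncard := by
  rw [D.posDistinctEigenvalue_eq]
  refine le_sSup_setOf_le_iff (f := fun t => (D.eigval '' {i | t ≤ D.eigval i}).ncard) (B := ‖T‖)
    (fun s s' hs hss => ?_) (fun s hs => ?_) (fun s hs h => ?_) hk ht
  · exact Set.ncard_le_ncard (Set.image_mono fun _ hi => hss.trans hi) ((D.finite_le hs).image _)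
  · obtain ⟨s', h1, h2, h3⟩ := D.exists_lt_setOf_le_eq hs
    exact ⟨s', h1, h2, by rw [h3]⟩
  · exact D.le_norm_of_nonempty
      (Set.image_nonempty.1 ((Set.ncard_pos ((D.finite_le hs).image _)).1 h))

theorem exists_posDistinctEigenvalue_eq {i : ι} (hi : 0 < D.eigval i) :
    ∃ k : ℕ, 1 ≤ k ∧ posDistinctEigenvalue T k = D.eigval i := by
  have hfin := (D.finite_le hi).image D.eigval
  have hmem : D.eigval i ∈ D.eigval '' {k | D.eigval i ≤ D.eigval k} :=
    Set.mem_image_of_mem _ (le_refl (D.eigval i))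
  -- The index is the number of distinct eigenvalues that are at least `D.eigval i`. A larger
  -- supremum would lose `D.eigval i` from the count.
  have hk := (Set.ncard_pos hfin).2 ⟨_, hmem⟩
  have hle := (D.le_posDistinctEigenvalue_iff hk hi).2 le_rfl
  refine ⟨_, hk, le_antisymm ?_ hle⟩
  by_contra! hlt
  have h1 := (D.le_posDistinctEigenvalue_iff hk (hi.trans hlt)).1 le_rfl
  refine absurd h1 (not_le.2 (Set.ncard_lt_ncard ⟨?_, fun h => ?_⟩ hfin))
  · exact Set.image_mono fun _ h => hle.trans h
  · obtain ⟨l, hl, hl'⟩ := h hmem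
    exact absurd (hl'.le.trans_lt hlt) (not_lt.2 hl)

/-- At least `k'` distinct eigenvalues are `≥ t`; dropping `t` itself leaves at least `k`, and their
minimum `m > t` is a lower bound for the `k`-th. -/
theorem posDistinctEigenvalue_lt {k k' : ℕ} (hk : 1 ≤ k) (hkk : k < k')
    (hpos : 0 < posDistinctEigenvalue T k') :
    posDistinctEigenvalue T k' < posDistinctEigenvalue T k := by
  set t := posDistinctEigenvalue T k' with ht
  have h1 := (D.le_posDistinctEigenvalue_iff (hk.trans hkk.le) hpos).1 ht.le
  set S := D.eigval '' {i | t ≤ D.eigval i}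
  have hfin : (S \ {t}).Finite := ((D.finite_le hpos).image _).subset Set.sdiff_subset
  have hcard : k ≤ (S \ {t}).ncard := by
    have := Set.pred_ncard_le_ncard_sdiff_singleton S t
    omega
  obtain ⟨m, ⟨hmS, hmt⟩, hmin⟩ := Set.exists_min_image _ id hfin
    ((Set.ncard_pos hfin).1 (hk.trans hcard))
  have htm : t < m := by
    obtain ⟨i, hi, rfl⟩ := hmS
    exact lt_of_le_of_ne hi fun h => hmt h.symm
  refine htm.trans_le ((D.le_posDistinctEigenvalue_iff hk (hpos.trans htm)).2 (hcard.trans ?_))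
  refine Set.ncard_le_ncard ?_ ((D.finite_le (hpos.trans htm)).image _)
  intro x hx
  obtain ⟨i, -, rfl⟩ := hx.1
  exact ⟨i, hmin _ hx, rfl⟩

theorem exists_distinctEigenvalue_eq {i : ι} (hi : D.eigval i ≠ 0) :
    ∃ j : ℤ, j ≠ 0 ∧ distinctEigenvalue T j = D.eigval i := by
  rcases hi.lt_or_gt with hi | hi
  · obtain ⟨k, hk, h⟩ := D.neg.exists_posDistinctEigenvalue_eq (i := i) (neg_pos.2 hi)
    refine ⟨-k, by omega, ?_⟩
    rw [← distinctEigenvalue_natCast _ hk, distinctEigenvalue_neg] at h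
    exact neg_injective h
  · obtain ⟨k, hk, h⟩ := D.exists_posDistinctEigenvalue_eq hi
    exact ⟨k, by omega, by rw [distinctEigenvalue_natCast _ hk, h]⟩

theorem eq_of_distinctEigenvalue_eq_of_pos {j j' : ℤ}
    (h : distinctEigenvalue T j = distinctEigenvalue T j') (h0 : 0 < distinctEigenvalue T j) :
    j = j' := by
  obtain ⟨k, hk, rfl⟩ := exists_natCast_of_distinctEigenvalue_pos h0
  obtain ⟨k', hk', rfl⟩ := exists_natCast_of_distinctEigenvalue_pos (h ▸ h0)
  rw [distinctEigenvalue_natCast _ hk] at h h0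
  rw [distinctEigenvalue_natCast _ hk'] at h
  rcases lt_trichotomy k k' with hlt | rfl | hlt
  · exact absurd h (D.posDistinctEigenvalue_lt hk hlt (h ▸ h0)).ne'
  · rfl
  · exact absurd h (D.posDistinctEigenvalue_lt hk' hlt h0).ne

theorem eq_of_distinctEigenvalue_eq {j j' : ℤ}
    (h : distinctEigenvalue T j = distinctEigenvalue T j') (h0 : distinctEigenvalue T j ≠ 0) :
    j = j' := by
  rcases h0.lt_or_gt with h0 | h0
  · refine neg_injective (D.neg.eq_of_distinctEigenvalue_eq_of_pos (j := -j) (j' := -j') ?_ ?_)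
    · simp [distinctEigenvalue_neg, h]
    · simpa [distinctEigenvalue_neg] using h0
  · exact D.eq_of_distinctEigenvalue_eq_of_pos h h0

/-- Weyl's inequality by the Courant–Fischer dimension count: the span of the eigenvectors of `T`
with eigenvalue `≥ t` has dimension at least `k`, so it contains a nonzero `v` orthogonal to the
fewer than `k` eigenvectors of `S` with eigenvalue `≥ t'`. Comparing the two quadratic forms at `v`
gives `t - t' ≤ ‖T - S‖`. -/
theorem posEigenvalue_le_add {κ : Type*} {S : H →L[ℂ] H} (D' : Diagonalization S κ) {k : ℕ}
    (hk : 1 ≤ k) : posEigenvalue T k ≤ posEigenvalue S k + ‖T - S‖ := by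
  by_contra! hlt
  have hS0 := posEigenvalue_nonneg S k
  set t := posEigenvalue T k with ht
  have ht0 : 0 < t := by linarith [norm_nonneg (T - S)]
  -- Strictly above the `k`-th eigenvalue of `S`, so that fewer than `k` eigenvalues reach `t'`, and
  -- strictly below `t - ‖T - S‖`, for the contradiction.
  obtain ⟨t', h1, h2⟩ := exists_between (lt_sub_iff_add_lt.2 hlt)
  have ht'0 : 0 < t' := by linarith
  have hkT := (D.le_posEigenvalue_iff hk ht0).1 le_rfl
  have hkS : {i | t' ≤ D'.eigval i}.ncard < k := by
    by_contra! h
    exact absurd ((D'.le_posEigenvalue_iff hk ht'0).2 h) (not_le.2 h1)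
  have hfS := D'.finite_le ht'0
  have := hfS.fintype
  set V := Submodule.span ℂ (D.basis '' {i | t ≤ D.eigval i})
  have : FiniteDimensional ℂ V :=
    FiniteDimensional.span_of_finite ℂ ((D.finite_le ht0).image _)
  let L : V →ₗ[ℂ] ({i | t' ≤ D'.eigval i} → ℂ) :=
    LinearMap.pi fun i => (innerSL ℂ (D'.basis i)).toLinearMap ∘ₗ V.subtype
  have hker : LinearMap.ker L ≠ ⊥ := by
    refine LinearMap.ker_ne_bot_of_finrank_lt ?_
    rw [D.finrank_span (D.finite_le ht0), Module.finrank_fintype_fun_eq_card,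
      ← Nat.card_eq_fintype_card, Nat.card_coe_set_eq]
    exact hkS.trans_le hkT
  obtain ⟨⟨v, hvV⟩, hvker, hv0⟩ := Submodule.exists_mem_ne_zero_of_ne_bot hker
  have hv0 : v ≠ 0 := fun h => hv0 (Subtype.ext h)
  have hvS : ∀ i, t' ≤ D'.eigval i → inner ℂ (D'.basis i) v = 0 := fun i hi => by
    exact congrFun (LinearMap.mem_ker.1 hvker) ⟨i, hi⟩
  have hA : t * ‖v‖ ^ 2 ≤ (inner ℂ v (T v)).re := by
    refine hasSum_le (fun i => ?_) ((D.basis.hasSum_norm_inner_sq v).mul_left t)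
      (D.hasSum_re_inner v)
    by_cases hi : t ≤ D.eigval i
    · gcongr
    · simp [D.inner_eq_zero_of_mem_span hvV (i := i) hi]
  have hB : (inner ℂ v (S v)).re ≤ t' * ‖v‖ ^ 2 := by
    refine hasSum_le (fun i => ?_) (D'.hasSum_re_inner v)
      ((D'.basis.hasSum_norm_inner_sq v).mul_left t')
    by_cases hi : t' ≤ D'.eigval i
    · simp [hvS i hi]
    · push Not at hi
      gcongr
  have hC : (inner ℂ v (T v)).re - (inner ℂ v (S v)).re ≤ ‖T - S‖ * ‖v‖ ^ 2 := by
    rw [← Complex.sub_re, ← inner_sub_right, ← sub_apply]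
    refine (Complex.re_le_norm _).trans ((norm_inner_le_norm _ _).trans ?_)
    have := (T - S).le_opNorm v
    nlinarith [norm_nonneg v]
  have : 0 < ‖v‖ ^ 2 := by positivity
  nlinarith

theorem abs_orderedEigenvalue_sub_le {κ : Type*} {S : H →L[ℂ] H} (D' : Diagonalization S κ)
    (i : ℤ) : |orderedEigenvalue T i - orderedEigenvalue S i| ≤ ‖T - S‖ := by
  have key : ∀ {T S : H →L[ℂ] H} (D : Diagonalization T ι) (D' : Diagonalization S κ) {k : ℕ},
      1 ≤ k → |posEigenvalue T k - posEigenvalue S k| ≤ ‖T - S‖ := by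
    intro T S D D' k hk
    have h1 := D.posEigenvalue_le_add D' hk
    have h2 := D'.posEigenvalue_le_add D hk
    rw [norm_sub_rev] at h2
    rw [abs_le]
    constructor <;> linarith
  rcases lt_trichotomy i 0 with h | rfl | h
  · have := key D.neg D'.neg (k := i.natAbs) (by omega)
    simp only [orderedEigenvalue, not_lt.2 h.le, h, if_true, if_false]
    rw [← neg_sub', abs_neg]
    refine this.trans_eq ?_
    rw [← neg_sub', norm_neg]
  · simp [orderedEigenvalue]
  · simp only [orderedEigenvalue, h, if_true]
    exact key D D' (by omega)

/-- Completeness by counting: if `N` eigenvalues are `≥ c`, then `φ 1, …, φ N` are `N` independent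
vectors in the `N`-dimensional space `V`, hence span it. The vector `v` lies in `V` and is
orthogonal to all of them: by hypothesis when the eigenvalue is `c`, by symmetry of `T` otherwise.
-/
theorem eq_zero_of_forall_inner_eq_zero_of_pos {φ : ℤ → H} (hφ : IsEigenfamily T φ) {c : ℝ}
    (hc : 0 < c) {v : H} (hv : T v = (c : ℂ) • v)
    (h : ∀ i, orderedEigenvalue T i = c → inner ℂ (φ i) v = 0) : v = 0 := by
  set N := {i | c ≤ D.eigval i}.ncard with hN
  -- `Fin N` starts at `0`, the positive eigenvalue indices at `1`.
  have hle : ∀ k : Fin N, c ≤ orderedEigenvalue T ((k : ℕ) + 1 : ℕ) := fun k => by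
    rw [orderedEigenvalue_natCast T (by omega), D.le_posEigenvalue_iff (by omega) hc]
    exact k.2
  have hmem : ∀ k : Fin N, (((k : ℕ) + 1 : ℕ) : ℤ) ∈ eigenIndices T := fun k =>
    (hc.trans_le (hle k)).ne'
  have hli : LinearIndependent ℂ (fun k : Fin N => φ ((k : ℕ) + 1 : ℕ)) := by
    refine hφ.orthonormal.linearIndependent.comp
      (fun k : Fin N => (⟨_, hmem k⟩ : eigenIndices T)) fun x y hxy => ?_
    have := congrArg Subtype.val hxy
    simp only at this
    ext; omega
  set V := Submodule.span ℂ (D.basis '' {i | c ≤ D.eigval i}) with hV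
  have hfV : FiniteDimensional ℂ V :=
    FiniteDimensional.span_of_finite ℂ ((D.finite_le hc).image _)
  have hspan : Submodule.span ℂ (Set.range fun k : Fin N => φ ((k : ℕ) + 1 : ℕ)) = V := by
    refine Submodule.eq_of_le_of_finrank_eq ?_ ?_
    · rw [Submodule.span_le]
      rintro _ ⟨k, rfl⟩
      refine D.mem_span (D.finite_le hc) fun i hi => ?_
      refine D.inner_eq_zero_of_apply_eq (hφ.eigen _ (hmem k)) fun heq => hi ?_
      exact (hle k).trans heq.ge
    · rw [finrank_span_eq_card hli, D.finrank_span (D.finite_le hc), Fintype.card_fin]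
  have hvV : v ∈ V := D.mem_span (D.finite_le hc) fun i hi =>
    D.inner_eq_zero_of_apply_eq hv fun heq => hi heq.ge
  have hperp : v ∈ Vᗮ := by
    rw [← hspan, Submodule.mem_orthogonal]
    intro u hu
    induction hu using Submodule.span_induction with
    | mem u hu =>
      obtain ⟨k, rfl⟩ := hu
      by_cases hk : orderedEigenvalue T ((k : ℕ) + 1 : ℕ) = c
      · exact h _ hk
      · have h1 := D.isSymmetric (φ ((k : ℕ) + 1 : ℕ)) v
        simp only [ContinuousLinearMap.coe_coe] at h1
        rw [hφ.eigen _ (hmem k), hv, inner_smul_left, inner_smul_right, Complex.conj_ofReal,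
          mul_eq_mul_right_iff] at h1
        exact h1.resolve_left fun h2 => hk (Complex.ofReal_injective h2)
    | zero => simp
    | add a b _ _ ha hb => rw [inner_add_left, ha, hb, add_zero]
    | smul c a _ ha => rw [inner_smul_left, ha, mul_zero]
  exact inner_self_eq_zero.1 ((Submodule.mem_orthogonal _ _).1 hperp v hvV)

/-- An eigenvector of `T` for a nonzero eigenvalue `c` that is orthogonal to all `φ i` with
`λᵢ = c` vanishes: these `φ i` span the eigenspace. -/
theorem eq_zero_of_forall_inner_eq_zero {φ : ℤ → H} (hφ : IsEigenfamily T φ) {c : ℝ}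
    (hc : c ≠ 0) {v : H} (hv : T v = (c : ℂ) • v)
    (h : ∀ i, orderedEigenvalue T i = c → inner ℂ (φ i) v = 0) : v = 0 := by
  rcases hc.lt_or_gt with hc | hc
  · refine D.neg.eq_zero_of_forall_inner_eq_zero_of_pos hφ.neg (neg_pos.2 hc) ?_ fun i hi => ?_
    · rw [neg_apply, hv]; simp
    · rw [orderedEigenvalue_neg, neg_inj] at hi
      exact h _ hi
  · exact D.eq_zero_of_forall_inner_eq_zero_of_pos hφ hc hv h

end Diagonalization

end Eigenvalues

/-! ### Spectral projections: traces, Bessel and Parseval. -/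

section Projections

variable {H : Type*} [NormedAddCommGroup H] [InnerProductSpace ℂ H]

/-- With `P = ∑ pᵢ ⊗ pᵢ`, this is the real part of the trace of `P A`, computed in the basis `b` and
independent of it. -/
theorem HilbertBasis.hasSum_re_inner_sum {κ : Type*} (b : HilbertBasis κ ℂ H) {α : Type*}
    (F : Finset α) (p : α → H) {A : H →L[ℂ] H} (hA : (A : H →ₗ[ℂ] H).IsSymmetric) :
    HasSum (fun e => (inner ℂ (∑ i ∈ F, inner ℂ (p i) (b e) • p i) (A (b e))).re)
      (∑ i ∈ F, (inner ℂ (A (p i)) (p i)).re) := by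
  have h : ∀ e, (inner ℂ (∑ i ∈ F, inner ℂ (p i) (b e) • p i) (A (b e))).re =
      ∑ i ∈ F, (inner ℂ (A (p i)) (b e) * inner ℂ (b e) (p i)).re := by
    intro e
    rw [sum_inner, Complex.re_sum]
    refine Finset.sum_congr rfl fun i _ => ?_
    have := hA (p i) (b e)
    simp only [ContinuousLinearMap.coe_coe] at this
    rw [inner_smul_left, inner_conj_symm, ← this, mul_comm]
  simp only [h]
  exact hasSum_sum fun i _ => Complex.hasSum_re (b.hasSum_inner_mul_inner _ _)

/-- The operator norm is at most the Hilbert–Schmidt norm. -/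
theorem norm_apply_sq_le_of_hasSum {κ : Type*} (b : HilbertBasis κ ℂ H) {A : H →L[ℂ] H}
    (hA : (A : H →ₗ[ℂ] H).IsSymmetric) {x : ℝ} (h : HasSum (fun e => ‖A (b e)‖ ^ 2) x) (v : H) :
    ‖A v‖ ^ 2 ≤ x * ‖v‖ ^ 2 := by
  refine hasSum_le (fun e => ?_) (b.hasSum_norm_inner_sq (A v)) (h.mul_right (‖v‖ ^ 2))
  have h1 := hA (b e) v
  simp only [ContinuousLinearMap.coe_coe] at h1
  rw [← h1, ← mul_pow]
  have := norm_inner_le_norm (𝕜 := ℂ) (A (b e)) v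
  gcongr

variable [CompleteSpace H] {T : H →L[ℂ] H} {φ : ℤ → H}

theorem hilbertSchmidtNorm_eq_of_forall_hasSum {A : H →L[ℂ] H} {x : ℝ}
    (h : ∀ {W : Set H} (b : HilbertBasis W ℂ H), HasSum (fun e => ‖A (b e)‖ ^ 2) x) :
    hilbertSchmidtNorm A = ENNReal.ofReal x ^ (1 / 2 : ℝ) := by
  obtain ⟨b, hb⟩ := (exists_hilbertBasis ℂ H).choose_spec
  have h1 := h b
  unfold hilbertSchmidtNorm
  congr 1
  rw [← h1.tsum_eq, ENNReal.ofReal_tsum_of_nonneg (fun _ => by positivity) h1.summable]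
  refine tsum_congr fun e => ?_
  rw [hb, ENNReal.ofReal_pow (norm_nonneg _), ofReal_norm]

theorem spectralProjection_isSymmetric (T : H →L[ℂ] H) (φ : ℤ → H) (I : Set ℤ) :
    (spectralProjection T φ I : H →ₗ[ℂ] H).IsSymmetric :=
  Submodule.starProjection_isSymmetric _

theorem inner_spectralProjection (T : H →L[ℂ] H) (φ : ℤ → H) (I : Set ℤ) (u v : H) :
    inner ℂ (spectralProjection T φ I u) v = inner ℂ u (spectralProjection T φ I v) :=
  Submodule.inner_starProjection_left_eq_right _ u v

theorem spectralProjection_idem (T : H →L[ℂ] H) (φ : ℤ → H) (I : Set ℤ) (v : H) :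
    spectralProjection T φ I (spectralProjection T φ I v) = spectralProjection T φ I v :=
  Submodule.starProjection_eq_self_iff.2 (Submodule.starProjection_apply_mem _ _)

theorem norm_spectralProjection_apply_le (T : H →L[ℂ] H) (φ : ℤ → H) (I : Set ℤ) (v : H) :
    ‖spectralProjection T φ I v‖ ≤ ‖v‖ :=
  Submodule.norm_starProjection_apply_le _ v

theorem spectralProjection_apply_self {I : Set ℤ} {i : ℤ} (hi : i ∈ I ∩ eigenIndices T) :
    spectralProjection T φ I (φ i) = φ i :=
  Submodule.starProjection_eq_self_iff.2
    (Submodule.le_topologicalClosure _ (Submodule.subset_span ⟨i, hi, rfl⟩))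

theorem inner_sub_spectralProjection {I : Set ℤ} {i : ℤ} (hi : i ∈ I ∩ eigenIndices T) (v : H) :
    inner ℂ (φ i) (v - spectralProjection T φ I v) = 0 := by
  rw [inner_sub_right, ← inner_spectralProjection, spectralProjection_apply_self hi, sub_self]

theorem re_inner_spectralProjection (T : H →L[ℂ] H) (φ : ℤ → H) (I : Set ℤ) (v : H) :
    (inner ℂ v (spectralProjection T φ I v)).re = ‖spectralProjection T φ I v‖ ^ 2 := by
  rw [← spectralProjection_idem, ← inner_spectralProjection, spectralProjection_idem,
    inner_self_eq_norm_sq_to_K]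
  norm_cast

theorem norm_sub_spectralProjection_sq (T : H →L[ℂ] H) (φ : ℤ → H) (I : Set ℤ) (v : H) :
    ‖v - spectralProjection T φ I v‖ ^ 2 = ‖v‖ ^ 2 - ‖spectralProjection T φ I v‖ ^ 2 := by
  rw [norm_sub_sq (𝕜 := ℂ)]
  have := re_inner_spectralProjection T φ I v
  rw [RCLike.re_eq_complex_re, this]
  ring

theorem spectralProjection_apply_eq_sum (hφ : IsEigenfamily T φ) {I : Set ℤ} {F : Finset ℤ}
    (hF : I ∩ eigenIndices T = F) (v : H) :
    spectralProjection T φ I v = ∑ i ∈ F, inner ℂ (φ i) v • φ i := by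
  have h := hasSum_spectralProjection hφ I v
  rw [hF] at h
  refine h.unique ?_
  exact F.hasSum fun i => inner ℂ (φ i) v • φ i

theorem hasSum_norm_spectralProjection_sq (hφ : IsEigenfamily T φ) (I : Set ℤ) (v : H) :
    HasSum (fun i : (I ∩ eigenIndices T : Set ℤ) => ‖inner ℂ (φ i) v‖ ^ 2)
      (‖spectralProjection T φ I v‖ ^ 2) := by
  have h := Complex.hasSum_re ((hasSum_spectralProjection hφ I v).mapL (innerSL ℂ v))
  rw [innerSL_apply_apply, re_inner_spectralProjection] at h
  convert h using 1
  funext i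
  rw [innerSL_apply_apply, InnerProductSpace.rankOne_apply, inner_smul_right,
    ← inner_conj_symm v, Complex.mul_conj']
  norm_cast

theorem enorm_spectralProjection_sq (hφ : IsEigenfamily T φ) (I : Set ℤ) (v : H) :
    ‖spectralProjection T φ I v‖ₑ ^ 2 =
      ∑' i : ℤ, (I ∩ eigenIndices T).indicator (fun i => ‖inner ℂ (φ i) v‖ₑ ^ 2) i := by
  have h := hasSum_norm_spectralProjection_sq hφ I v
  rw [← tsum_subtype, ← ofReal_norm, ← ENNReal.ofReal_pow (norm_nonneg _), ← h.tsum_eq,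
    ENNReal.ofReal_tsum_of_nonneg (fun _ => by positivity) h.summable]
  refine tsum_congr fun i => ?_
  rw [ENNReal.ofReal_pow (norm_nonneg _), ofReal_norm]

/-- Pythagoras for disjoint index sets, obtained by interchanging nonnegative sums: every index is
counted in at most one `B j`. -/
theorem tsum_enorm_spectralProjection_sq (hφ : IsEigenfamily T φ) {J : Type*} {B : J → Set ℤ}
    (hB : ∀ i j j', i ∈ B j → i ∈ B j' → j = j') (v : H) :
    ∑' j, ‖spectralProjection T φ (B j) v‖ₑ ^ 2 =
      ‖spectralProjection T φ (⋃ j, B j) v‖ₑ ^ 2 := by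
  simp only [enorm_spectralProjection_sq hφ]
  rw [ENNReal.tsum_comm]
  refine tsum_congr fun i => ?_
  by_cases hi : ∃ j, i ∈ B j
  · obtain ⟨j, hj⟩ := hi
    rw [tsum_eq_single j]
    · by_cases h : i ∈ eigenIndices T
      · have h1 : i ∈ B j ∩ eigenIndices T := ⟨hj, h⟩
        have h2 : i ∈ (⋃ j, B j) ∩ eigenIndices T := ⟨Set.mem_iUnion_of_mem j hj, h⟩
        rw [Set.indicator_of_mem h1, Set.indicator_of_mem h2]
      · rw [Set.indicator_of_notMem fun h' => h h'.2, Set.indicator_of_notMem fun h' => h h'.2]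
    · exact fun j' hj' => Set.indicator_of_notMem (fun h => hj' (hB i j' j h.1 hj)) _
  · rw [Set.indicator_of_notMem fun h => hi (Set.mem_iUnion.1 h.1), ENNReal.tsum_eq_zero]
    exact fun j => Set.indicator_of_notMem (fun h => hi ⟨j, h.1⟩) _

/-- The squared Hilbert–Schmidt distance of two spectral projections of finite rank. -/
theorem hasSum_norm_spectralProjection_sub_sq {S : H →L[ℂ] H} {ψ : ℤ → H}
    (hφ : IsEigenfamily T φ) (hψ : IsEigenfamily S ψ) {I J : Set ℤ} {F G : Finset ℤ}
    (hF : I ∩ eigenIndices T = F) (hG : J ∩ eigenIndices S = G)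
    {κ : Type*} (b : HilbertBasis κ ℂ H) :
    HasSum (fun e => ‖(spectralProjection S ψ J - spectralProjection T φ I) (b e)‖ ^ 2)
      ((F.card : ℝ) - G.card + 2 * ∑ i ∈ G, ‖ψ i - spectralProjection T φ I (ψ i)‖ ^ 2) := by
  set P := spectralProjection S ψ J with hP
  set Q := spectralProjection T φ I with hQ
  have hPs := spectralProjection_isSymmetric S ψ J
  have hQs := spectralProjection_isSymmetric T φ I
  -- Expanding `‖(P - Q) e‖²` and summing over `e` gives the traces of `P`, `P Q` and `Q`: the ranks
  -- `|G|` and `|F|`, and `|G|` minus the defect `∑ ‖ψᵢ - Q ψᵢ‖²`.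
  have hPP := b.hasSum_re_inner_sum G ψ hPs
  have hPQ := b.hasSum_re_inner_sum G ψ hQs
  have hQQ := b.hasSum_re_inner_sum F φ hQs
  simp only [← spectralProjection_apply_eq_sum hψ hG, ← spectralProjection_apply_eq_sum hφ hF]
    at hPP hPQ hQQ
  have hψ1 : ∀ i ∈ G, ‖ψ i‖ = 1 := fun i hi =>
    hψ.orthonormal.1 ⟨i, ((Set.ext_iff.1 hG i).2 hi).2⟩
  have hφ1 : ∀ i ∈ F, ‖φ i‖ = 1 := fun i hi =>
    hφ.orthonormal.1 ⟨i, ((Set.ext_iff.1 hF i).2 hi).2⟩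
  have h1 : ∑ i ∈ G, (inner ℂ (P (ψ i)) (ψ i)).re = G.card := by
    rw [Finset.sum_congr rfl fun i hi => ?_, Finset.sum_const, nsmul_eq_mul, mul_one]
    rw [hP, spectralProjection_apply_self ((Set.ext_iff.1 hG i).2 hi), inner_self_eq_norm_sq_to_K,
      hψ1 i hi]
    norm_num
  have h2 : ∑ i ∈ F, (inner ℂ (Q (φ i)) (φ i)).re = F.card := by
    rw [Finset.sum_congr rfl fun i hi => ?_, Finset.sum_const, nsmul_eq_mul, mul_one]
    rw [hQ, spectralProjection_apply_self ((Set.ext_iff.1 hF i).2 hi), inner_self_eq_norm_sq_to_K,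
      hφ1 i hi]
    norm_num
  have h3 : ∑ i ∈ G, (inner ℂ (Q (ψ i)) (ψ i)).re =
      G.card - ∑ i ∈ G, ‖ψ i - Q (ψ i)‖ ^ 2 := by
    rw [eq_sub_iff_add_eq, ← Finset.sum_add_distrib, Finset.sum_congr rfl fun i hi => ?_,
      Finset.sum_const, nsmul_eq_mul, mul_one]
    rw [hQ, norm_sub_spectralProjection_sq, inner_spectralProjection, re_inner_spectralProjection,
      hψ1 i hi]
    ring
  rw [h1] at hPP
  rw [h2] at hQQ
  rw [h3] at hPQ
  have hfun : (fun e => ‖(P - Q) (b e)‖ ^ 2) = fun e => (inner ℂ (P (b e)) (P (b e))).re -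
      2 * (inner ℂ (P (b e)) (Q (b e))).re + (inner ℂ (Q (b e)) (Q (b e))).re := by
    funext e
    rw [sub_apply, norm_sub_sq (𝕜 := ℂ), RCLike.re_eq_complex_re, inner_self_eq_norm_sq_to_K,
      inner_self_eq_norm_sq_to_K]
    norm_cast
  have hval : (F.card : ℝ) - G.card + 2 * ∑ i ∈ G, ‖ψ i - Q (ψ i)‖ ^ 2 =
      G.card - 2 * (G.card - ∑ i ∈ G, ‖ψ i - Q (ψ i)‖ ^ 2) + F.card := by ring
  rw [hfun, hval]
  exact (hPP.sub (hPQ.mul_left 2)).add hQQ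

end Projections

/-- Scheffé-type argument: a finite set `F` carries almost all the mass of `a₀`, termwise
convergence carries this over to `a n`, and the bound by `‖f n‖²` leaves little mass outside `F`. -/
theorem tendsto_tsum_enorm_sub_sq {E J : Type*} [NormedAddCommGroup E]
    {a : ℕ → J → E} {a₀ : J → E} {f : ℕ → E} {f₀ : E}
    (ha : ∀ j, Tendsto (fun n => a n j) atTop (𝓝 (a₀ j))) (hf : Tendsto f atTop (𝓝 f₀))
    (hle : ∀ n, ∑' j, ‖a n j‖ₑ ^ 2 ≤ ‖f n‖ₑ ^ 2) (heq : ∑' j, ‖a₀ j‖ₑ ^ 2 = ‖f₀‖ₑ ^ 2) :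
    Tendsto (fun n => ∑' j, ‖a n j - a₀ j‖ₑ ^ 2) atTop (𝓝 0) := by
  classical
  have hconv : ∀ (G : Finset J) (b : J → E),
      ∑ j ∈ G, ‖b j‖ₑ ^ 2 = ENNReal.ofReal (∑ j ∈ G, ‖b j‖ ^ 2) := by
    intro G b
    rw [ENNReal.ofReal_sum_of_nonneg fun _ _ => by positivity]
    refine Finset.sum_congr rfl fun j _ => ?_
    rw [ENNReal.ofReal_pow (norm_nonneg _), ofReal_norm]
  have hbound : ∀ (b : J → E) (g : E), ∑' j, ‖b j‖ₑ ^ 2 ≤ ‖g‖ₑ ^ 2 →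
      ∀ G : Finset J, ∑ j ∈ G, ‖b j‖ ^ 2 ≤ ‖g‖ ^ 2 := by
    intro b g h G
    have h1 := (ENNReal.sum_le_tsum G).trans h
    rw [hconv, ← ofReal_norm, ← ENNReal.ofReal_pow (norm_nonneg _)] at h1
    exact (ENNReal.ofReal_le_ofReal_iff (by positivity)).1 h1
  have hsum : HasSum (fun j => ‖a₀ j‖ ^ 2) (‖f₀‖ ^ 2) := by
    have hs : Summable fun j => ‖a₀ j‖ ^ 2 :=
      summable_of_sum_le (fun _ => by positivity) (hbound a₀ f₀ heq.le)
    have h1 : ENNReal.ofReal (∑' j, ‖a₀ j‖ ^ 2) = ENNReal.ofReal (‖f₀‖ ^ 2) := by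
      rw [ENNReal.ofReal_tsum_of_nonneg (fun _ => by positivity) hs,
        ENNReal.ofReal_pow (norm_nonneg _), ofReal_norm, ← heq]
      refine tsum_congr fun j => ?_
      rw [ENNReal.ofReal_pow (norm_nonneg _), ofReal_norm]
    rw [ENNReal.ofReal_eq_ofReal_iff (tsum_nonneg fun _ => by positivity) (by positivity)] at h1
    exact h1 ▸ hs.hasSum
  rw [ENNReal.tendsto_atTop_zero]
  intro ε hε
  -- The error is `η` on `F`; outside `F` it is at most twice the mass `2η` of `a n` plus twice the
  -- mass `η` of `a₀`. Together `7η`.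
  obtain ⟨η, hη0, hη⟩ : ∃ η : ℝ, 0 < η ∧ ENNReal.ofReal (7 * η) ≤ ε := by
    rcases eq_or_ne ε ∞ with rfl | hε'
    · exact ⟨1, one_pos, le_top⟩
    · refine ⟨ε.toReal / 7, div_pos (ENNReal.toReal_pos hε.ne' hε') (by norm_num), ?_⟩
      rw [mul_div_cancel₀ _ (by norm_num), ENNReal.ofReal_toReal hε']
  obtain ⟨F, hF⟩ : ∃ F : Finset J, ‖f₀‖ ^ 2 - η < ∑ j ∈ F, ‖a₀ j‖ ^ 2 :=
    (hsum.eventually (lt_mem_nhds (by linarith))).exists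
  have e1 : Tendsto (fun n => ∑ j ∈ F, ‖a n j‖ ^ 2) atTop (𝓝 (∑ j ∈ F, ‖a₀ j‖ ^ 2)) :=
    tendsto_finsetSum F fun j _ => (ha j).norm.pow 2
  have e2 : Tendsto (fun n => ∑ j ∈ F, ‖a n j - a₀ j‖ ^ 2) atTop (𝓝 0) := by
    have : Tendsto (fun n => ∑ j ∈ F, ‖a n j - a₀ j‖ ^ 2) atTop
        (𝓝 (∑ j ∈ F, ‖a₀ j - a₀ j‖ ^ 2)) :=
      tendsto_finsetSum F fun j _ => ((ha j).sub_const _).norm.pow 2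
    simpa using this
  have e3 : Tendsto (fun n => ‖f n‖ ^ 2) atTop (𝓝 (‖f₀‖ ^ 2)) := hf.norm.pow 2
  have hev := (e1.eventually (lt_mem_nhds hF)).and ((e2.eventually (gt_mem_nhds hη0)).and
    (e3.eventually (gt_mem_nhds (show ‖f₀‖ ^ 2 < ‖f₀‖ ^ 2 + η by linarith))))
  obtain ⟨N, hN⟩ := eventually_atTop.1 hev
  refine ⟨N, fun n hn => ?_⟩
  obtain ⟨h1, h2, h3⟩ := hN n hn
  refine le_trans ?_ hη
  rw [ENNReal.tsum_eq_iSup_sum]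
  refine iSup_le fun G => ?_
  rw [hconv]
  refine ENNReal.ofReal_le_ofReal ?_
  have g1 : ∑ j ∈ G, ‖a n j - a₀ j‖ ^ 2 ≤ ∑ j ∈ F ∪ G, ‖a n j - a₀ j‖ ^ 2 :=
    Finset.sum_le_sum_of_subset_of_nonneg Finset.subset_union_right fun _ _ _ => by positivity
  rw [← Finset.union_sdiff_self_eq_union, Finset.sum_union Finset.disjoint_sdiff] at g1
  have g2 : ∑ j ∈ G \ F, ‖a n j - a₀ j‖ ^ 2 ≤
      2 * ∑ j ∈ G \ F, ‖a n j‖ ^ 2 + 2 * ∑ j ∈ G \ F, ‖a₀ j‖ ^ 2 := by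
    rw [Finset.mul_sum, Finset.mul_sum, ← Finset.sum_add_distrib]
    refine Finset.sum_le_sum fun j _ => ?_
    have := norm_sub_le (a n j) (a₀ j)
    nlinarith [sq_nonneg (‖a n j‖ - ‖a₀ j‖), norm_nonneg (a n j - a₀ j)]
  have g3 := hbound _ _ (hle n) (F ∪ G)
  have g4 := hbound _ _ heq.le (F ∪ G)
  rw [← Finset.union_sdiff_self_eq_union, Finset.sum_union Finset.disjoint_sdiff] at g3 g4
  linarith

/-! ### Spectral gap and convergence of the projections. -/

section Convergence

variable {H : Type*} [NormedAddCommGroup H] [InnerProductSpace ℂ H] {T : H →L[ℂ] H} {φ : ℤ → H}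

theorem eigenBlock_subset (T : H →L[ℂ] H) (j : ℤ) : eigenBlock T j ⊆ eigenIndices T :=
  fun _ hi => hi.1

theorem IsHilbertSchmidtSymmetric.finite_eigenBlock {C : ℝ} (hT : IsHilbertSchmidtSymmetric T C)
    (hφ : IsEigenfamily T φ) {j : ℤ} (hj : distinctEigenvalue T j ≠ 0) :
    (eigenBlock T j).Finite := by
  have h := hT.finite_of_le_norm hφ.orthonormal (abs_pos.2 hj)
  refine (h.image Subtype.val).subset fun i hi => ⟨⟨i, hi.1⟩, ?_, rfl⟩
  change _ ≤ ‖T (φ i)‖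
  have h1 : ‖φ i‖ = 1 := hφ.orthonormal.1 ⟨i, hi.1⟩
  rw [hφ.eigen i hi.1, norm_smul, h1, mul_one, Complex.norm_real, Real.norm_eq_abs, hi.2]

theorem mem_eigenBlock_of_eq {i j : ℤ} (hj : distinctEigenvalue T j ≠ 0)
    (h : orderedEigenvalue T i = distinctEigenvalue T j) : i ∈ eigenBlock T j :=
  ⟨by rw [eigenIndices, Set.mem_ofPred_eq, h]; exact hj, h⟩

namespace Diagonalization

variable {ι : Type*} (D : Diagonalization T ι)
include D

/-- Eigenvalues of modulus below `|c| / 2` are at distance at least `|c| / 2` from `c`, and only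
finitely many others exist. -/
theorem exists_gap {c : ℝ} (hc : c ≠ 0) : ∃ δ > 0, ∀ i, D.eigval i ≠ c → δ ≤ |D.eigval i - c| := by
  have hc' := abs_pos.2 hc
  have hfin := ((D.finite_le_abs (|c| / 2) (by positivity)).image
    (fun i => |D.eigval i - c|)).subset (Set.sep_subset _ fun x => x ≠ 0)
  obtain ⟨m, hm, hmin⟩ := (insert (|c| / 2) hfin.toFinset).exists_min_image id
    ⟨_, Finset.mem_insert_self _ _⟩
  refine ⟨m, ?_, fun i hi => ?_⟩
  · rcases Finset.mem_insert.1 hm with rfl | h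
    · positivity
    · obtain ⟨⟨i, -, rfl⟩, hi⟩ := (Set.Finite.mem_toFinset _).1 h
      exact lt_of_le_of_ne (abs_nonneg _) hi.symm
  · by_cases h : |c| / 2 ≤ |D.eigval i|
    · exact hmin _ (Finset.mem_insert_of_mem ((Set.Finite.mem_toFinset _).2
        ⟨⟨i, h, rfl⟩, abs_ne_zero.2 (sub_ne_zero.2 hi)⟩))
    · have h1 : m ≤ |c| / 2 := hmin _ (Finset.mem_insert_self _ _)
      have h2 := abs_sub_abs_le_abs_sub c (D.eigval i)
      rw [abs_sub_comm] at h2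
      linarith

theorem eigenIndices_subset_iUnion (hφ : IsEigenfamily T φ) :
    eigenIndices T ⊆ ⋃ j : {j : ℤ // j ≠ 0}, eigenBlock T j := by
  intro i hi
  have h1 : ‖φ i‖ = 1 := hφ.orthonormal.1 ⟨i, hi⟩
  obtain ⟨k, hk⟩ : ∃ k, D.eigval k = orderedEigenvalue T i := by
    by_contra! h
    have h0 := D.mem_span Set.finite_empty fun k _ =>
      D.inner_eq_zero_of_apply_eq (hφ.eigen i hi) (h k)
    simp only [Set.image_empty, Submodule.span_empty, Submodule.mem_bot] at h0
    simp [h0] at h1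
  obtain ⟨j, hj0, hj⟩ := D.exists_distinctEigenvalue_eq (i := k) (hk ▸ hi)
  exact Set.mem_iUnion.2 ⟨⟨j, hj0⟩, hi, by rw [hj, hk]⟩

theorem eq_of_mem_eigenBlock {i j j' : ℤ} (h : i ∈ eigenBlock T j) (h' : i ∈ eigenBlock T j') :
    j = j' :=
  D.eq_of_distinctEigenvalue_eq (h.2.symm.trans h'.2) (h.2 ▸ h.1)

end Diagonalization

variable [CompleteSpace H]

theorem apply_spectralProjection_eigenBlock (hφ : IsEigenfamily T φ) (j : ℤ) (v : H) :
    T (spectralProjection T φ (eigenBlock T j) v) =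
      (distinctEigenvalue T j : ℂ) • spectralProjection T φ (eigenBlock T j) v := by
  have h := hasSum_spectralProjection hφ (eigenBlock T j) v
  refine (h.mapL T).unique ?_
  convert h.const_smul (distinctEigenvalue T j : ℂ) using 2 with i
  rw [InnerProductSpace.rankOne_apply, map_smul, hφ.eigen _ i.2.2, i.2.1.2, smul_comm]

namespace Diagonalization

variable {ι : Type*} (D : Diagonalization T ι)
include D

theorem spectralProjection_eigenBlock_eq_self (hφ : IsEigenfamily T φ) {j : ℤ}
    (hj : distinctEigenvalue T j ≠ 0) {v : H} (hv : T v = (distinctEigenvalue T j : ℂ) • v) :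
    spectralProjection T φ (eigenBlock T j) v = v := by
  refine (sub_eq_zero.1 (D.eq_zero_of_forall_inner_eq_zero hφ hj ?_ fun i hi => ?_)).symm
  · rw [map_sub, hv, apply_spectralProjection_eigenBlock hφ, smul_sub]
  · have := mem_eigenBlock_of_eq hj hi
    exact inner_sub_spectralProjection ⟨this, this.1⟩ v

/-- Removing the `c`-component `P v` does not change `T v - c v`. The remainder has coordinates only
at eigenvalues other than `c`, and `T - c` stretches each of them by at least the gap. -/
theorem exists_norm_sub_spectralProjection_le (hφ : IsEigenfamily T φ) {j : ℤ}
    (hj : distinctEigenvalue T j ≠ 0) :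
    ∃ δ > 0, ∀ v, δ * ‖v - spectralProjection T φ (eigenBlock T j) v‖ ≤
      ‖T v - (distinctEigenvalue T j : ℂ) • v‖ := by
  obtain ⟨δ, hδ, hgap⟩ := D.exists_gap hj
  refine ⟨δ, hδ, fun v => ?_⟩
  set c := distinctEigenvalue T j with hc
  set r := v - spectralProjection T φ (eigenBlock T j) v with hr
  have hTr : T v - (c : ℂ) • v = T r - (c : ℂ) • r := by
    rw [hr, map_sub, apply_spectralProjection_eigenBlock hφ, smul_sub]
    abel
  rw [hTr]
  refine le_of_sq_le_sq ?_ (norm_nonneg _)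
  rw [mul_pow]
  refine hasSum_le (fun i => ?_) ((D.basis.hasSum_norm_inner_sq r).mul_left (δ ^ 2))
    (D.hasSum_norm_sub_smul_sq c r)
  by_cases hi : D.eigval i = c
  · have h1 : T (D.basis i) = (c : ℂ) • D.basis i := by rw [D.apply_basis, hi]
    rw [← D.spectralProjection_eigenBlock_eq_self hφ hj h1, inner_spectralProjection, hr, map_sub,
      spectralProjection_idem, sub_self]
    simp
  · have := hgap i hi
    rw [← sq_abs (D.eigval i - c)]
    gcongr

/-- The remainder `f - P f` is orthogonal to every `φ i`, hence to all nonzero eigenspaces, and to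
the kernel, since both `f` and `P f` are. So it is orthogonal to an eigenbasis. -/
theorem spectralProjection_eq_self_of_kernelProjection_eq_zero (hφ : IsEigenfamily T φ) {f : H}
    (hf : kernelProjection T f = 0) {I : Set ℤ} (hI : eigenIndices T ⊆ I) :
    spectralProjection T φ I f = f := by
  set v := f - spectralProjection T φ I f with hv
  have hφv : ∀ i ∈ eigenIndices T, inner ℂ (φ i) v = 0 := fun i hi =>
    inner_sub_spectralProjection ⟨hI hi, hi⟩ f
  have hker : ∀ u, T u = 0 → inner ℂ u v = 0 := by
    intro u hu
    have h1 : inner ℂ u f = 0 := (Submodule.starProjection_apply_eq_zero_iff _).1 hf u hu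
    have h2 : spectralProjection T φ I u = 0 := by
      refine (hasSum_spectralProjection hφ I u).unique ?_
      convert hasSum_zero (α := H) using 2 with i
      have h3 := D.isSymmetric (φ i) u
      simp only [ContinuousLinearMap.coe_coe] at h3
      rw [hu, inner_zero_right, hφ.eigen _ i.2.2, inner_smul_left, Complex.conj_ofReal,
        mul_eq_zero] at h3
      rw [InnerProductSpace.rankOne_apply,
        h3.resolve_left (Complex.ofReal_ne_zero.2 i.2.2), zero_smul]
    rw [hv, inner_sub_right, h1, ← inner_spectralProjection, h2, inner_zero_left, sub_zero]
  have hb : ∀ i, inner ℂ (D.basis i) v = 0 := by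
    intro i
    by_cases hi : D.eigval i = 0
    · exact hker _ (by rw [D.apply_basis, hi]; simp)
    · obtain ⟨j, -, hj⟩ := D.exists_distinctEigenvalue_eq hi
      have hj0 : distinctEigenvalue T j ≠ 0 := hj ▸ hi
      have h1 : T (D.basis i) = (distinctEigenvalue T j : ℂ) • D.basis i := by
        rw [D.apply_basis, hj]
      have h2 : spectralProjection T φ (eigenBlock T j) v = 0 := by
        refine (hasSum_spectralProjection hφ _ v).unique ?_
        convert hasSum_zero (α := H) using 2 with i
        rw [InnerProductSpace.rankOne_apply, hφv i i.2.2, zero_smul]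
      rw [← D.spectralProjection_eigenBlock_eq_self hφ hj0 h1, inner_spectralProjection, h2,
        inner_zero_right]
  have h0 := D.mem_span Set.finite_empty fun i _ => hb i
  simp only [Set.image_empty, Submodule.span_empty, Submodule.mem_bot] at h0
  exact (sub_eq_zero.1 h0).symm

end Diagonalization

/-- Convergence of the spectral projections of self-adjoint Hilbert–Schmidt operators that
converge in operator norm. -/
theorem tendsto_hilbertSchmidtNorm_spectralProjection_sub {C : ℝ} {T' : ℕ → H →L[ℂ] H}
    (hT : IsHilbertSchmidtSymmetric T C) (hT' : ∀ n, IsHilbertSchmidtSymmetric (T' n) C)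
    (hlim : Tendsto T' atTop (𝓝 T)) {φ' : ℕ → ℤ → H} (hφ : IsEigenfamily T φ)
    (hφ' : ∀ n, IsEigenfamily (T' n) (φ' n)) {j : ℤ} (hj : distinctEigenvalue T j ≠ 0) :
    Tendsto (fun n => hilbertSchmidtNorm (spectralProjection (T' n) (φ' n) (eigenBlock T j) -
        spectralProjection T φ (eigenBlock T j))) atTop (𝓝 0) ∧
      Tendsto (fun n => spectralProjection (T' n) (φ' n) (eigenBlock T j)) atTop
        (𝓝 (spectralProjection T φ (eigenBlock T j))) := by
  obtain ⟨ι, ⟨D⟩⟩ := hT.exists_diagonalization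
  choose κ hκ using fun n => (hT' n).exists_diagonalization
  have D' := fun n => (hκ n).some
  obtain ⟨δ, hδ, hgap⟩ := D.exists_norm_sub_spectralProjection_le hφ hj
  set B := eigenBlock T j with hB
  set c := distinctEigenvalue T j with hc
  have hfin : B.Finite := hT.finite_eigenBlock hφ hj
  set F := hfin.toFinset with hFdef
  have hF : B ∩ eigenIndices T = F := by
    rw [Set.inter_eq_left.2 (eigenBlock_subset T j), hFdef, Set.Finite.coe_toFinset]
  set ε : ℕ → ℝ := fun n => ‖T - T' n‖ with hεdef
  have hε : Tendsto ε atTop (𝓝 0) := by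
    have := (tendsto_const_nhds (x := T)).sub hlim
    rw [sub_self] at this
    simpa using this.norm
  have hweyl : ∀ n, ∀ i ∈ B, |c - orderedEigenvalue (T' n) i| ≤ ε n := fun n i hi => by
    have := D.abs_orderedEigenvalue_sub_le (D' n) i
    rwa [hi.2] at this
  -- For large `n` no index of the block is lost: `λᵢ(T' n) = 0` would contradict Weyl once `ε n <
  -- |c|`. Both projections then have the same rank.
  have hF' : ∀ᶠ n in atTop, B ∩ eigenIndices (T' n) = F := by
    filter_upwards [hε.eventually (gt_mem_nhds (abs_pos.2 hj))] with n hn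
    rw [hFdef, Set.Finite.coe_toFinset, Set.inter_eq_left]
    intro i hi h0
    have := hweyl n i hi
    rw [h0, sub_zero] at this
    exact absurd hn (not_lt.2 this)
  -- The squared Hilbert–Schmidt distance once the ranks cancel.
  let x : ℕ → ℝ := fun n => 2 * ∑ i ∈ F, ‖φ' n i - spectralProjection T φ B (φ' n i)‖ ^ 2
  have hHS : ∀ᶠ n in atTop, ∀ {W : Set H} (b : HilbertBasis W ℂ H),
      HasSum (fun e => ‖(spectralProjection (T' n) (φ' n) B - spectralProjection T φ B) (b e)‖ ^ 2)
        (x n) := by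
    filter_upwards [hF'] with n hn W b
    have := hasSum_norm_spectralProjection_sub_sq hφ (hφ' n) hF hn b
    rwa [sub_self, zero_add] at this
  have hx : Tendsto x atTop (𝓝 0) := by
    have hlim2 : Tendsto (fun n => 2 * ∑ i ∈ F, (δ⁻¹ * (2 * ε n)) ^ 2) atTop (𝓝 0) := by
      have : Tendsto (fun n => 2 * ∑ i ∈ F, (δ⁻¹ * (2 * ε n)) ^ 2) atTop
          (𝓝 (2 * ∑ i ∈ F, (δ⁻¹ * (2 * 0)) ^ 2)) :=
        (tendsto_finsetSum F fun _ _ => ((hε.const_mul 2).const_mul δ⁻¹).pow 2).const_mul 2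
      simpa using this
    refine squeeze_zero' (Eventually.of_forall fun n => ?_) ?_ hlim2
    · exact mul_nonneg zero_le_two (Finset.sum_nonneg fun _ _ => by positivity)
    · filter_upwards [hF'] with n hn
      refine mul_le_mul_of_nonneg_left (Finset.sum_le_sum fun i hi => ?_) zero_le_two
      obtain ⟨hiB, hin⟩ := (Set.ext_iff.1 hn i).2 hi
      refine pow_le_pow_left₀ (norm_nonneg _) ?_ 2
      rw [le_inv_mul_iff₀ hδ]
      refine (hgap (φ' n i)).trans ?_
      have h1 : ‖φ' n i‖ = 1 := (hφ' n).orthonormal.1 ⟨i, hin⟩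
      -- Approximate eigenvector: one `ε n` comes from replacing `T' n` by `T`, another from
      -- replacing its eigenvalue by `c`.
      have h2 : T (φ' n i) - (c : ℂ) • φ' n i =
          (T - T' n) (φ' n i) - ((c - orderedEigenvalue (T' n) i : ℝ) : ℂ) • φ' n i := by
        rw [sub_apply, (hφ' n).eigen i hin, Complex.ofReal_sub, sub_smul]
        abel
      rw [h2]
      refine (norm_sub_le _ _).trans ?_
      have h3 := (T - T' n).le_opNorm (φ' n i)
      have h4 := hweyl n i hiB
      rw [norm_smul, h1, mul_one, Complex.norm_real, Real.norm_eq_abs]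
      rw [h1, mul_one] at h3
      linarith
  constructor
  · have h1 : Tendsto (fun n => ENNReal.ofReal (x n) ^ (1 / 2 : ℝ)) atTop (𝓝 0) := by
      have := ((ENNReal.continuous_rpow_const (y := (1 / 2 : ℝ))).tendsto _).comp
        (ENNReal.tendsto_ofReal hx)
      simpa [Function.comp_def] using this
    refine h1.congr' ?_
    filter_upwards [hHS] with n hn
    exact (hilbertSchmidtNorm_eq_of_forall_hasSum hn).symm
  · rw [tendsto_iff_norm_sub_tendsto_zero]
    have h1 := hx.sqrt
    rw [Real.sqrt_zero] at h1
    refine squeeze_zero' (Eventually.of_forall fun _ => norm_nonneg _) ?_ h1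
    filter_upwards [hHS] with n hn
    obtain ⟨W, b, -⟩ := exists_hilbertBasis ℂ H
    have hsum := hn b
    have h0 : 0 ≤ x n := hsum.nonneg fun _ => by positivity
    refine ContinuousLinearMap.opNorm_le_bound _ (Real.sqrt_nonneg _) fun v => ?_
    refine le_of_sq_le_sq ?_ (by positivity)
    rw [mul_pow, Real.sq_sqrt h0]
    refine norm_apply_sq_le_of_hasSum b (fun u v => ?_) hsum v
    simp [inner_sub_left, inner_sub_right, inner_spectralProjection]

theorem tendsto_tsum_spectralProjection_sub {C : ℝ} {T' : ℕ → H →L[ℂ] H}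
    (hT : IsHilbertSchmidtSymmetric T C) (hT' : ∀ n, IsHilbertSchmidtSymmetric (T' n) C)
    (hlim : Tendsto T' atTop (𝓝 T)) {φ' : ℕ → ℤ → H} (hφ : IsEigenfamily T φ)
    (hφ' : ∀ n, IsEigenfamily (T' n) (φ' n)) {f : H} {f' : ℕ → H}
    (hf' : Tendsto f' atTop (𝓝 f)) (hf : kernelProjection T f = 0) :
    Tendsto (fun n => ∑' j : {j : ℤ // j ≠ 0},
      ‖spectralProjection (T' n) (φ' n) (eigenBlock T j) (f' n) -
        spectralProjection T φ (eigenBlock T j) f‖ₑ ^ 2) atTop (𝓝 0) := by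
  obtain ⟨ι, ⟨D⟩⟩ := hT.exists_diagonalization
  have hdisj : ∀ (i : ℤ) (j j' : {j : ℤ // j ≠ 0}), i ∈ eigenBlock T j → i ∈ eigenBlock T j' →
      j = j' := fun i j j' h h' => Subtype.ext (D.eq_of_mem_eigenBlock h h')
  refine tendsto_tsum_enorm_sub_sq (fun j => ?_) hf' (fun n => ?_) ?_
  · by_cases hj : distinctEigenvalue T j = 0
    -- Padded indices have `μⱼ = 0`; their blocks are empty and both projections vanish.
    · have hempty : eigenBlock T j = ∅ :=
        Set.eq_empty_of_forall_notMem fun i hi => hi.1 (hi.2.trans hj)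
      have h0 : ∀ (S : H →L[ℂ] H) (ψ : ℤ → H) (v : H), spectralProjection S ψ ∅ v = 0 := by
        intro S ψ v
        refine Submodule.starProjection_apply_eq_zero_iff _ |>.2 ?_
        simp
      simp only [hempty, h0]
      exact tendsto_const_nhds
    · have h := (tendsto_hilbertSchmidtNorm_spectralProjection_sub hT hT' hlim hφ hφ' hj).2
      exact (isBoundedBilinearMap_apply.continuous.tendsto _).comp (h.prodMk_nhds hf')
  · rw [tsum_enorm_spectralProjection_sq (hφ' n) hdisj]
    gcongr
    exact enorm_le_iff_norm_le.2 (norm_spectralProjection_apply_le _ _ _ _)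
  · rw [tsum_enorm_spectralProjection_sq hφ hdisj,
      D.spectralProjection_eq_self_of_kernelProjection_eq_zero hφ hf
        (D.eigenIndices_subset_iUnion hφ)]

end Convergence

/-! ### From the cut norm to the operator norm. -/

section CutNorm

variable {X : Type*} [MeasurableSpace X] {μ : Measure X}

/-- Test on the sets where `h` is nonnegative and nonpositive, after passing to a measurable
representative. -/
theorem integral_norm_le_of_forall_abs_setIntegral_le {h : X → ℝ} (hh : Integrable h μ) {K : ℝ}
    (hK : ∀ S, MeasurableSet S → |∫ x in S, h x ∂μ| ≤ K) : ∫ x, ‖h x‖ ∂μ ≤ 2 * K := by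
  obtain ⟨h', hm, heq⟩ := hh.aestronglyMeasurable
  have hh' : Integrable h' μ := hh.congr heq
  have hK' : ∀ S, MeasurableSet S → |∫ x in S, h' x ∂μ| ≤ K := fun S hS => by
    rw [← integral_congr_ae (ae_restrict_of_ae heq)]
    exact hK S hS
  have hnorm : ∫ x, ‖h x‖ ∂μ = ∫ x, ‖h' x‖ ∂μ := integral_congr_ae (heq.fun_comp norm)
  rw [hnorm, integral_norm_eq_pos_sub_neg hh']
  have h1 := hK' {x | 0 ≤ h' x} (measurableSet_le measurable_const hm.measurable)
  have h2 := hK' {x | h' x ≤ 0} (measurableSet_le hm.measurable measurable_const)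
  linarith [(abs_le.1 h1).2, (abs_le.1 h2).1]

theorem integral_norm_le_of_forall_norm_setIntegral_le {h : X → ℂ} (hh : Integrable h μ) {K : ℝ}
    (hK : ∀ S, MeasurableSet S → ‖∫ x in S, h x ∂μ‖ ≤ K) : ∫ x, ‖h x‖ ∂μ ≤ 4 * K := by
  have hre : Integrable (fun x => (h x).re) μ := hh.re
  have him : Integrable (fun x => (h x).im) μ := hh.im
  have h1 : ∫ x, ‖(h x).re‖ ∂μ ≤ 2 * K :=
    integral_norm_le_of_forall_abs_setIntegral_le hre fun S hS => by
      have : ∫ x in S, (h x).re ∂μ = (∫ x in S, h x ∂μ).re := integral_re hh.integrableOn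
      rw [this]
      exact (Complex.abs_re_le_norm _).trans (hK S hS)
  have h2 : ∫ x, ‖(h x).im‖ ∂μ ≤ 2 * K :=
    integral_norm_le_of_forall_abs_setIntegral_le him fun S hS => by
      have : ∫ x in S, (h x).im ∂μ = (∫ x in S, h x ∂μ).im := integral_im hh.integrableOn
      rw [this]
      exact (Complex.abs_im_le_norm _).trans (hK S hS)
  have h3 : ∫ x, ‖h x‖ ∂μ ≤ ∫ x, (‖(h x).re‖ + ‖(h x).im‖) ∂μ :=
    integral_mono hh.norm (hre.norm.add him.norm) fun x => Complex.norm_le_abs_re_add_abs_im _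
  rw [integral_add hre.norm him.norm] at h3
  linarith

theorem Lp.norm_sq_eq_integral (f : Lp ℂ 2 μ) : ‖f‖ ^ 2 = ∫ x, ‖f x‖ ^ 2 ∂μ := by
  have h : ((‖f‖ ^ 2 : ℝ) : ℂ) = ((∫ x, ‖f x‖ ^ 2 ∂μ : ℝ) : ℂ) := by
    rw [← integral_complex_ofReal]
    have h1 := inner_self_eq_norm_sq_to_K (𝕜 := ℂ) f
    rw [L2.inner_def] at h1
    push_cast
    refine Eq.trans h1.symm (integral_congr_ae (Eventually.of_forall fun x => ?_))
    exact inner_self_eq_norm_sq_to_K (𝕜 := ℂ) (f x)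
  exact Complex.ofReal_injective h

theorem Lp.integrable_norm_sq (f : Lp ℂ 2 μ) : Integrable (fun x => ‖f x‖ ^ 2) μ :=
  (Lp.memLp f).integrable_norm_pow (by norm_num)

theorem Graphon.abs_sub_toFun_le (w w' : Graphon μ) (x y : X) :
    |w'.toFun x y - w.toFun x y| ≤ 1 := by
  have h1 := w.mem_Icc x y
  have h2 := w'.mem_Icc x y
  rw [abs_le]
  constructor <;> linarith [h1.1, h1.2, h2.1, h2.2]

variable [IsProbabilityMeasure μ]

theorem integrable_mul_comp_snd {U : X → X → ℝ}
    (hU : AEStronglyMeasurable (fun p : X × X => U p.1 p.2) (μ.prod μ)) (hU1 : ∀ x y, |U x y| ≤ 1)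
    {ξ : X → ℂ} (hξ : Integrable ξ μ) :
    Integrable (fun p : X × X => (U p.1 p.2 : ℂ) * ξ p.2) (μ.prod μ) := by
  refine (hξ.comp_snd μ).bdd_mul (c := 1) (Complex.continuous_ofReal.comp_aestronglyMeasurable hU)
    (Eventually.of_forall fun p => ?_)
  rw [Complex.norm_real]
  exact hU1 _ _

/-- A kernel with small cut norm maps bounded functions to functions with small `L¹` norm. -/
theorem integral_norm_integral_mul_le {U : X → X → ℝ}
    (hU : AEStronglyMeasurable (fun p : X × X => U p.1 p.2) (μ.prod μ)) (hU1 : ∀ x y, |U x y| ≤ 1)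
    {c : ℝ} (hc : ∀ S T, MeasurableSet S → MeasurableSet T →
      |∫ p in S ×ˢ T, U p.1 p.2 ∂μ.prod μ| ≤ c)
    {ξ : X → ℂ} (hξ : Integrable ξ μ) {M : ℝ} (hM : ∀ᵐ x ∂μ, ‖ξ x‖ ≤ M) :
    ∫ x, ‖∫ y, (U x y : ℂ) * ξ y ∂μ‖ ∂μ ≤ 8 * M * c := by
  have hM0 : 0 ≤ M := by
    obtain ⟨x, hx⟩ := hM.exists
    exact (norm_nonneg _).trans hx
  have hint := integrable_mul_comp_snd hU hU1 hξ
  have hUint : Integrable (fun p : X × X => U p.1 p.2) (μ.prod μ) :=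
    Integrable.of_bound hU 1 (Eventually.of_forall fun p => hU1 _ _)
  have hprod : ∀ S T : Set X, (μ.restrict S).prod (μ.restrict T) ≤ μ.prod μ := fun S T => by
    rw [Measure.prod_restrict]
    exact Measure.restrict_le_self
  -- By Fubini the integral is `∫ ξ(y) (∫_S U(x, y) dx) dy`, at most `M` times the `L¹` norm of the
  -- inner integral, which the cut norm bounds by `2 c`. Splitting the outer function into real and
  -- imaginary parts costs the remaining factor 4.
  have hbound : ∀ S, MeasurableSet S →
      ‖∫ x in S, ∫ y, (U x y : ℂ) * ξ y ∂μ ∂μ‖ ≤ M * (2 * c) := by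
    intro S hS
    have hUS : Integrable (fun p : X × X => U p.1 p.2) ((μ.restrict S).prod μ) := by
      have := hUint.mono_measure (hprod S Set.univ)
      rwa [Measure.restrict_univ] at this
    have hintS : Integrable (fun p : X × X => (U p.1 p.2 : ℂ) * ξ p.2) ((μ.restrict S).prod μ) := by
      have := hint.mono_measure (hprod S Set.univ)
      rwa [Measure.restrict_univ] at this
    have h1int : Integrable (fun y => ∫ x in S, U x y ∂μ) μ := hUS.integral_prod_right
    have h1 : ∫ y, ‖∫ x in S, U x y ∂μ‖ ∂μ ≤ 2 * c := by
      refine integral_norm_le_of_forall_abs_setIntegral_le h1int fun T hT => ?_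
      have : ∫ y in T, ∫ x in S, U x y ∂μ ∂μ = ∫ p in S ×ˢ T, U p.1 p.2 ∂μ.prod μ := by
        rw [setIntegral_prod _ hUint.integrableOn]
        exact (integral_integral_swap (hUint.mono_measure (hprod S T))).symm
      rw [this]
      exact hc S T hS hT
    rw [integral_integral_swap hintS]
    refine (norm_integral_le_of_norm_le (h1int.norm.const_mul M) ?_).trans ?_
    · filter_upwards [hM] with y hy
      rw [integral_mul_const, integral_complex_ofReal, norm_mul, Complex.norm_real, mul_comm]
      gcongr
    · rw [integral_const_mul]
      gcongr
  have := integral_norm_le_of_forall_norm_setIntegral_le hint.integral_prod_left hbound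
  linarith

theorem Lp.integrable_of_two (f : Lp ℂ 2 μ) : Integrable f μ :=
  (Lp.memLp f).integrable (by norm_num)

namespace Graphon

theorem inner_operator_left (w : Graphon μ) (ξ η : Lp ℂ 2 μ) :
    inner ℂ (w.operator ξ) η = inner ℂ ξ (w.operator η) := by
  have hconj : Integrable (fun y => (starRingEnd ℂ) (ξ y)) μ :=
    (Complex.conjCLE : ℂ →L[ℝ] ℂ).integrable_comp (Lp.integrable_of_two ξ)
  have hprod : ∀ f g : X → ℂ, Integrable f μ → Integrable g μ →
      Integrable (fun p : X × X => (w.toFun p.1 p.2 : ℂ) * (f p.1 * g p.2)) (μ.prod μ) :=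
    fun f g hf hg => (hf.mul_prod hg).bdd_mul (c := 1)
      (Complex.continuous_ofReal.comp_aestronglyMeasurable w.aestronglyMeasurable)
      (Eventually.of_forall fun p => w.norm_toFun_le _ _)
  have h1 : inner ℂ (w.operator ξ) η =
      ∫ p : X × X, (w.toFun p.1 p.2 : ℂ) * (η p.1 * (starRingEnd ℂ) (ξ p.2)) ∂μ.prod μ := by
    rw [integral_prod _ (hprod _ _ (Lp.integrable_of_two η) hconj), L2.inner_def]
    refine integral_congr_ae ?_
    filter_upwards [w.operator_coeFn ξ] with x hx
    rw [RCLike.inner_apply, hx, ← integral_conj, ← integral_const_mul]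
    congr 1
    funext y
    rw [map_mul, Complex.conj_ofReal]
    ring
  have h2 : inner ℂ ξ (w.operator η) =
      ∫ p : X × X, (w.toFun p.1 p.2 : ℂ) * ((starRingEnd ℂ) (ξ p.1) * η p.2) ∂μ.prod μ := by
    rw [integral_prod _ (hprod _ _ hconj (Lp.integrable_of_two η)), L2.inner_def]
    refine integral_congr_ae ?_
    filter_upwards [w.operator_coeFn η] with x hx
    rw [RCLike.inner_apply, hx, ← integral_mul_const]
    congr 1
    funext y
    ring
  rw [h1, h2, ← integral_prod_swap]
  refine integral_congr_ae ?_
  filter_upwards [w.symm] with p hp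
  simp only [Prod.fst_swap, Prod.snd_swap]
  rw [← hp, mul_comm (η p.2)]

/-- For almost every `x`, `(T e)(x)` is the inner product of `e` with the row `w(x, ·)`, of norm at
most 1. Bessel bounds the sum of squares pointwise by 1; then integrate over `x`. -/
theorem isHilbertSchmidtSymmetric_operator (w : Graphon μ) :
    IsHilbertSchmidtSymmetric w.operator 1 where
  isSymmetric := w.inner_operator_left
  sum_le' := fun F hF => by
    simp only [Lp.norm_sq_eq_integral]
    rw [← integral_finsetSum _ fun e _ => Lp.integrable_norm_sq _]
    have h1 : ∫ _ : X, (1 : ℝ) ∂μ = 1 := by simp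
    rw [← h1]
    refine integral_mono_ae (integrable_finsetSum _ fun e _ => Lp.integrable_norm_sq _)
      (integrable_const _) ?_
    have hop : ∀ᵐ x ∂μ, ∀ e ∈ F, w.operator e x = ∫ y, (w.toFun x y : ℂ) * e y ∂μ :=
      (Finset.eventually_all F).2 fun e _ => w.operator_coeFn e
    filter_upwards [hop, w.aestronglyMeasurable.prodMk_left] with x hx hmeas
    have hmem : MemLp (fun y => (w.toFun x y : ℂ)) 2 μ :=
      MemLp.of_bound (Complex.continuous_ofReal.comp_aestronglyMeasurable hmeas) 1
        (Eventually.of_forall fun y => w.norm_toFun_le x y)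
    have hinner : ∀ e : Lp ℂ 2 μ,
        inner ℂ (hmem.toLp _) e = ∫ y, (w.toFun x y : ℂ) * e y ∂μ := fun e => by
      rw [L2.inner_def]
      refine integral_congr_ae ?_
      filter_upwards [hmem.coeFn_toLp] with y hy
      rw [RCLike.inner_apply, hy, Complex.conj_ofReal, mul_comm]
    have hnorm : ‖hmem.toLp _‖ ≤ 1 := by
      refine (Lp.norm_le_of_ae_bound zero_le_one (f := hmem.toLp _) (C := 1) ?_).trans ?_
      · filter_upwards [hmem.coeFn_toLp] with y hy
        rw [hy]
        exact w.norm_toFun_le x y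
      · simp [measureUnivNNReal]
    calc ∑ e ∈ F, ‖w.operator e x‖ ^ 2
        = ∑ e ∈ F.attach, ‖inner ℂ (e : Lp ℂ 2 μ) (hmem.toLp _)‖ ^ 2 := by
          rw [← Finset.sum_attach]
          refine Finset.sum_congr rfl fun e _ => ?_
          rw [hx e e.2, ← hinner, norm_inner_symm]
      _ ≤ ‖hmem.toLp _‖ ^ 2 := hF.sum_inner_products_le _
      _ ≤ 1 := pow_le_one₀ (norm_nonneg _) hnorm

theorem operator_sub_coeFn (w w' : Graphon μ) (ξ : Lp ℂ 2 μ) :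
    (w'.operator - w.operator) ξ =ᵐ[μ]
      fun x => ∫ y, ((w'.toFun x y - w.toFun x y : ℝ) : ℂ) * ξ y ∂μ := by
  rw [sub_apply]
  filter_upwards [Lp.coeFn_sub (w'.operator ξ) (w.operator ξ), w.operator_coeFn ξ,
    w'.operator_coeFn ξ, w.ae_integrable ξ, w'.ae_integrable ξ] with x h1 h2 h3 h4 h5
  rw [h1, Pi.sub_apply, h2, h3, ← integral_sub h5 h4]
  congr 1
  funext y
  rw [Complex.ofReal_sub, sub_mul]

theorem norm_operator_sub_apply_le (w w' : Graphon μ) (ξ : Lp ℂ 2 μ) :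
    ∀ᵐ x ∂μ, ‖(w'.operator - w.operator) ξ x‖ ≤ ∫ y, ‖ξ y‖ ∂μ := by
  filter_upwards [w.operator_sub_coeFn w' ξ] with x hx
  rw [hx]
  refine norm_integral_le_of_norm_le (Lp.integrable_of_two ξ).norm
    (Eventually.of_forall fun y => ?_)
  rw [norm_mul, Complex.norm_real]
  exact mul_le_of_le_one_left (norm_nonneg _) (w.abs_sub_toFun_le w' x y)

/-- The squared `L²` norm is at most `L∞` norm times `L¹` norm: the first is at most `‖ξ‖₁ ≤ M`, the
second at most `8 M c`. -/
theorem norm_operator_sub_apply_sq_le (w w' : Graphon μ) {c : ℝ}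
    (hc : ∀ S T, MeasurableSet S → MeasurableSet T →
      |∫ p in S ×ˢ T, (w'.toFun p.1 p.2 - w.toFun p.1 p.2) ∂μ.prod μ| ≤ c)
    {ξ : Lp ℂ 2 μ} {M : ℝ} (hM : ∀ᵐ x ∂μ, ‖ξ x‖ ≤ M) :
    ‖(w'.operator - w.operator) ξ‖ ^ 2 ≤ 8 * M ^ 2 * c := by
  have hM0 : 0 ≤ M := by
    obtain ⟨x, hx⟩ := hM.exists
    exact (norm_nonneg _).trans hx
  have hL1 : ∫ y, ‖ξ y‖ ∂μ ≤ M := by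
    have := integral_mono_ae (Lp.integrable_of_two ξ).norm (integrable_const M) hM
    simpa using this
  have h := integral_norm_integral_mul_le (μ := μ)
    (U := fun x y => w'.toFun x y - w.toFun x y)
    (w'.aestronglyMeasurable.sub w.aestronglyMeasurable) (w.abs_sub_toFun_le w') hc
    (Lp.integrable_of_two ξ) hM
  have hnorm : ∫ x, ‖(w'.operator - w.operator) ξ x‖ ∂μ =
      ∫ x, ‖∫ y, ((w'.toFun x y - w.toFun x y : ℝ) : ℂ) * ξ y ∂μ‖ ∂μ :=
    integral_congr_ae ((w.operator_sub_coeFn w' ξ).fun_comp norm)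
  rw [← hnorm] at h
  rw [Lp.norm_sq_eq_integral]
  calc ∫ x, ‖(w'.operator - w.operator) ξ x‖ ^ 2 ∂μ
      ≤ ∫ x, M * ‖(w'.operator - w.operator) ξ x‖ ∂μ := by
        refine integral_mono_ae (Lp.integrable_norm_sq _)
          ((Lp.integrable_of_two _).norm.const_mul M) ?_
        filter_upwards [w.norm_operator_sub_apply_le w' ξ] with x hx
        rw [sq]
        exact mul_le_mul_of_nonneg_right (hx.trans hL1) (norm_nonneg _)
    _ ≤ M * (8 * M * c) := by
        rw [integral_const_mul]
        exact mul_le_mul_of_nonneg_left h hM0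
    _ = 8 * M ^ 2 * c := by ring

/-- Closeness in cut norm implies closeness of the integral operators in operator norm. -/
theorem norm_operator_sub_le (w w' : Graphon μ) {ε M : ℝ} (hε : 0 ≤ ε) (hM : 0 < M)
    (hc : ∀ S T, MeasurableSet S → MeasurableSet T →
      |∫ p in S ×ˢ T, (w'.toFun p.1 p.2 - w.toFun p.1 p.2) ∂μ.prod μ| ≤ ε ^ 2 / (8 * M ^ 2)) :
    ‖w'.operator - w.operator‖ ≤ ε + 1 / M := by
  refine ContinuousLinearMap.opNorm_le_of_unit_norm (by positivity) fun ξ hξ => ?_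
  -- Truncation at height `M`: the bounded part is controlled by the cut norm, the tail by its `L¹`
  -- norm.
  set A : Set X := {x | ‖ξ x‖ ≤ M}
  have hA : MeasurableSet A :=
    measurableSet_le (Lp.stronglyMeasurable ξ).norm.measurable measurable_const
  have hmem : MemLp (A.indicator ξ) 2 μ := (Lp.memLp ξ).indicator hA
  set ξ₁ : Lp ℂ 2 μ := hmem.toLp _
  have hξ₁ : ∀ᵐ x ∂μ, ‖ξ₁ x‖ ≤ M := by
    filter_upwards [hmem.coeFn_toLp] with x hx
    rw [hx]
    by_cases h : x ∈ A
    · rw [Set.indicator_of_mem h]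
      exact h
    · rw [Set.indicator_of_notMem h, norm_zero]
      exact hM.le
  have h1 : ‖(w'.operator - w.operator) ξ₁‖ ≤ ε := by
    refine le_of_sq_le_sq ((w.norm_operator_sub_apply_sq_le w' hc hξ₁).trans_eq ?_) hε
    field_simp
  have h2 : ‖(w'.operator - w.operator) (ξ - ξ₁)‖ ≤ 1 / M := by
    have htail : ∫ y, ‖(ξ - ξ₁ : Lp ℂ 2 μ) y‖ ∂μ ≤ 1 / M := by
      -- Chebyshev: where `‖ξ‖ > M`, `‖ξ‖ ≤ ‖ξ‖² / M`.
      have hsq : ∫ y, ‖ξ y‖ ^ 2 / M ∂μ = 1 / M := by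
        rw [integral_div, ← Lp.norm_sq_eq_integral, hξ, one_pow]
      rw [← hsq]
      refine integral_mono_ae (Lp.integrable_of_two _).norm
        ((Lp.integrable_norm_sq ξ).div_const M) ?_
      filter_upwards [Lp.coeFn_sub ξ ξ₁, hmem.coeFn_toLp] with x hx hx'
      rw [hx, Pi.sub_apply, hx']
      by_cases h : x ∈ A
      · rw [Set.indicator_of_mem h, sub_self, norm_zero]
        positivity
      · rw [Set.indicator_of_notMem h, sub_zero, le_div_iff₀ hM, sq]
        exact mul_le_mul_of_nonneg_left (not_le.1 h).le (norm_nonneg _)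
    refine (Lp.norm_le_of_ae_bound (by positivity) (C := 1 / M) ?_).trans ?_
    · filter_upwards [w.norm_operator_sub_apply_le w' (ξ - ξ₁)] with x hx
      exact hx.trans htail
    · simp [measureUnivNNReal]
  calc ‖(w'.operator - w.operator) ξ‖
      = ‖(w'.operator - w.operator) ξ₁ + (w'.operator - w.operator) (ξ - ξ₁)‖ := by
        rw [← map_add, add_sub_cancel]
    _ ≤ ε + 1 / M := (norm_add_le _ _).trans (add_le_add h1 h2)

theorem tendsto_operator {w : Graphon μ} {w' : ℕ → Graphon μ}
    (h : Tendsto (fun n => cutNorm μ (fun x y => (w' n).toFun x y - w.toFun x y)) atTop (𝓝 0)) :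
    Tendsto (fun n => (w' n).operator) atTop (𝓝 w.operator) := by
  rw [Metric.tendsto_atTop]
  intro ε hε
  -- Then `1 / M = ε / 4`, and the total bound is `ε / 2`.
  set M : ℝ := 4 / ε with hM
  have hM0 : 0 < M := by positivity
  have hpos : 0 < (ε / 4) ^ 2 / (8 * M ^ 2) := by positivity
  obtain ⟨N, hN⟩ := ENNReal.tendsto_atTop_zero.1 h _ (ENNReal.ofReal_pos.2 hpos)
  refine ⟨N, fun n hn => ?_⟩
  rw [dist_eq_norm]
  refine (w.norm_operator_sub_le (w' n) (ε := ε / 4) (by positivity) hM0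
    fun S T hS hT => ?_).trans_lt ?_
  · rw [← Real.norm_eq_abs, ← ENNReal.ofReal_le_ofReal_iff hpos.le, ofReal_norm]
    refine le_trans ?_ (hN n hn)
    exact le_iSup₂_of_le S T (le_iSup₂_of_le hS hT le_rfl)
  · rw [hM, one_div_div]
    linarith

end Graphon

end CutNorm

/-! ### The theorem for graphon signals. -/

theorem theorem3p7 {X : Type*} [MeasurableSpace X] (μ : Measure X) [IsProbabilityMeasure μ]
    (w : Graphon μ) (f : Lp ℂ 2 μ) (w' : ℕ → Graphon μ) (f' : ℕ → Lp ℂ 2 μ)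
    (hconv : SignalsConvergeInNorm w' f' w f)
    (φ : ℤ → Lp ℂ 2 μ) (hφ : IsEigenfamily w.operator φ)
    (φ' : ℕ → ℤ → Lp ℂ 2 μ) (hφ' : ∀ n, IsEigenfamily (w' n).operator (φ' n)) :
    (∀ j : ℤ, j ≠ 0 → distinctEigenvalue w.operator j ≠ 0 →
      Tendsto
        (fun n => hilbertSchmidtNorm
          (spectralProjection (w' n).operator (φ' n) (eigenBlock w.operator j) -
            spectralProjection w.operator φ (eigenBlock w.operator j)))
        atTop (𝓝 0) ∧
      Tendsto
        (fun n => spectralProjection (w' n).operator (φ' n) (eigenBlock w.operator j) (f' n))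
        atTop (𝓝 (spectralProjection w.operator φ (eigenBlock w.operator j) f))) ∧
    (kernelProjection w.operator f = 0 →
      Tendsto
        (fun n => ∑' j : {j : ℤ // j ≠ 0},
          ‖spectralProjection (w' n).operator (φ' n) (eigenBlock w.operator j) (f' n) -
            spectralProjection w.operator φ (eigenBlock w.operator j) f‖ₑ ^ 2)
        atTop (𝓝 0)) := by
  have hT := w.isHilbertSchmidtSymmetric_operator
  have hT' := fun n => (w' n).isHilbertSchmidtSymmetric_operator
  have hlim := Graphon.tendsto_operator hconv.1
  have hf' : Tendsto f' atTop (𝓝 f) := tendsto_iff_norm_sub_tendsto_zero.2 hconv.2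
  refine ⟨fun j _ hj => ?_, tendsto_tsum_spectralProjection_sub hT hT' hlim hφ hφ' hf'⟩
  obtain ⟨h1, h2⟩ :=
    tendsto_hilbertSchmidtNorm_spectralProjection_sub hT hT' hlim hφ hφ' hj
  exact ⟨h1, (isBoundedBilinearMap_apply.continuous.tendsto _).comp (h2.prodMk_nhds hf')⟩
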